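/- Let $A=(A^1,\dots,A^d)$ be complex $D\times D$ matrices. For $n\ge 1$ let $|\psi_n\rangle=\sum_{i_1,\dots,i_n}\mathrm{tr}[A^{i_1}\cdots A^{i_n}]\,|i_1\dots i_n\rangle\in(\mathbb C^d)^{\otimes n}$ be the translation-invariant matrix product state with periodic boundary conditions and let $\rho^{(n)}=|\psi_n\rangle\langle\psi_n|/\langle\psi_n|\psi_n\rangle$ (this is defined for all large $n$ under the assumption below). For a finite set $X$ of sites let $\rho^{(n)}_X$ be its reduced density matrix, and for $k\ge 2$, $k\mid n$, let $\rho^{(n)}_k$ be the reduced density matrix of the spins whose number is a multiple of $k$. Let $S_\alpha(\rho)=\frac1{1-\alpha}\log\mathrm{tr}[\rho^\alpha]$ for $\alpha\in(1,\infty)$ and $S_\infty(\rho)=-\log\|\rho\|$. Let $T=\sum_i A^i\otimes\overline{A^i}$ be the transfer operator, $\mathcal T[X]=\sum_i A^iX(A^i)^\dagger$ the corresponding completely positive map, and $\hat T_k=(T\otimes T)^{k-1}U(T\otimes T)U$ the twisted transfer operator on $(\mathbb C^D)^{\otimes 4}$, where $U$ exchanges the second and the fourth tensor factor. Assume that $T$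 is gapped and normalized: counted with algebraic multiplicity, $1$ is a simple eigenvalue of $T$ and all other eigenvalues have modulus less than $1$. (a) For every $k\ge 2$, the limit inferior being taken along the multiples $n$ of $k$, $$\liminf_{n\to\infty}\frac kn S_2\big(\rho_k^{(n)}\big)=-\log\big|\hat t_1^{(k)}\big|,$$ where $\hat t_1^{(k)}\neq 0$ is an eigenvalue of $\hat T_k$ of largest modulus. (b) Assume in addition that, up to a gauge transformation $A^i\mapsto GA^iG^{-1}$ with $G$ invertible, the tensor is in canonical form: there are nonzero, mutually orthogonal orthogonal projections $P_1,\dots,P_m$ with $\sum_jP_j=\mathbb 1$, numbers $\lambda_j\ge 0$ and matrices $A^i_{(j)}=P_jA^i_{(j)}P_j$ with $A^i=\sum_j\lambda_jA^i_{(j)}$ such that, for each $j$, the fixed points of $\mathcal T_j[X]=\sum_iA^i_{(j)}X(A^i_{(j)})^\dagger$ are exactly the multiples of $P_j$, and the adjoint map $\mathcal T_j^*[X]=\sum_i(A^i_{(j)})^\dagger XA^i_{(j)}$ has a fixed point $\Lambda_j\ge 0$ that vanishes on the orthogonal complement of the range of $P_j$ and has full rank on that range. Then the following are equivalent: (i)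 the eigenvector of $T$ with eigenvalue $1$ is a product vector $|\phi\rangle\otimes|\chi\rangle$; (i') the eigenoperator of $\mathcal T$ with eigenvalue $1$ has rank $1$; (ii) for every $k_0$ there is $k\ge\max(k_0,2)$ with $\liminf_{n\to\infty}\frac kn S_2(\rho^{(n)}_k)=0$ (along the multiples $n$ of $k$); (iii) for every $\alpha\in(1,\infty]$ and every $k\ge 2$, $S_\alpha(\rho^{(n)}_k)\to 0$ as $n\to\infty$ along the multiples of $k$; (iv) for every finite set $X$ of sites there are density matrices $\sigma_x$ on $\mathbb C^d$ ($x\in X$) with $\rho^{(n)}_X\to\bigotimes_{x\in X}\sigma_x$ as $n\to\infty$; (iv') there is a unit vector $|\varphi\rangle\in\mathbb C^d$ such that, for every finite set $X$ of sites, $\rho^{(n)}_X\to\bigotimes_{x\in X}|\varphi\rangle\langle\varphi|$ as $n\to\infty$. -/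

import Mathlib

open scoped Kronecker ENNReal Topology ComplexOrder

/-- The Rényi-`α` entropy, `0 ≤ α ≤ ∞`, of a Hermitian matrix `ρ` (in practice a density matrix),
in terms of its eigenvalues with multiplicity. For `α ≠ 0, 1, ∞` this is
`(1 - α)⁻¹ log tr ρ ^ α`; `α = 0` is the log of the rank, `α = 1` the von Neumann entropy, and
`α = ∞` is minus the log of the operator norm (the largest modulus of an eigenvalue). -/
noncomputable def renyiEntropy {m : Type} [Fintype m] [DecidableEq m] {ρ : Matrix m m ℂ}
    (hρ : ρ.IsHermitian) (α : ℝ≥0∞) : ℝ :=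
  if α = 0 then Real.log (ρ.rank : ℝ)
  else if α = 1 then ∑ i, Real.negMulLog (hρ.eigenvalues i)
  else if α = ⊤ then -Real.log (⨆ i, |hρ.eigenvalues i|)
  else (1 / (1 - α.toReal)) * Real.log (∑ i, (hρ.eigenvalues i) ^ α.toReal)

namespace MPS

variable {d D : ℕ}

/-- The (unnormalized) translation-invariant matrix product state vector on `n` spins with periodic
boundary conditions: `ψ^{i₁,…,iₙ} = tr (A^{i₁} ⋯ A^{iₙ})`. -/
noncomputable def stateVector (A : Fin d → Matrix (Fin D) (Fin D) ℂ) (n : ℕ)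
    (s : Fin n → Fin d) : ℂ :=
  (List.ofFn fun j => A (s j)).prod.trace

/-- The normalized density matrix `|ψ⟩⟨ψ| / ⟨ψ|ψ⟩` of the chain of `n` spins. -/
noncomputable def densityMatrix (A : Fin d → Matrix (Fin D) (Fin D) ℂ) (n : ℕ) :
    Matrix (Fin n → Fin d) (Fin n → Fin d) ℂ :=
  (star (stateVector A n) ⬝ᵥ stateVector A n)⁻¹ •
    Matrix.vecMulVec (stateVector A n) (star (stateVector A n))

/-- The configuration of `n` spins that is `a` on the sites in `X` and `c` on the other sites. The
sites of the chain carry the labels `0, …, n - 1`. -/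
def glue {n : ℕ} {X : Finset ℕ} (a : X → Fin d) (c : {j : Fin n // (j : ℕ) ∉ X} → Fin d) :
    Fin n → Fin d :=
  fun j => if h : (j : ℕ) ∈ X then a ⟨j, h⟩ else c ⟨j, h⟩

/-- The reduced density matrix of the sites in `X ⊆ {0, …, n - 1}`: the partial trace of the density
matrix of the chain of `n` spins over all sites that are not in `X`. -/
noncomputable def reducedState (A : Fin d → Matrix (Fin D) (Fin D) ℂ) (n : ℕ) (X : Finset ℕ) :
    Matrix (X → Fin d) (X → Fin d) ℂ :=
  Matrix.of fun a b =>
    ∑ c : {j : Fin n // (j : ℕ) ∉ X} → Fin d, densityMatrix A n (glue a c) (glue b c)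

theorem densityMatrix_isHermitian (A : Fin d → Matrix (Fin D) (Fin D) ℂ) (n : ℕ) :
    (densityMatrix A n).IsHermitian := by
  have h : star (star (stateVector A n) ⬝ᵥ stateVector A n) =
      star (stateVector A n) ⬝ᵥ stateVector A n := by
    rw [← Matrix.star_dotProduct_star, star_star, dotProduct_comm]
  unfold densityMatrix Matrix.IsHermitian
  rw [Matrix.conjTranspose_smul, star_inv₀, h, Matrix.conjTranspose_vecMulVec, star_star]

theorem reducedState_isHermitian (A : Fin d → Matrix (Fin D) (Fin D) ℂ) (n : ℕ) (X : Finset ℕ) :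
    (reducedState A n X).IsHermitian := by
  ext a b
  simp only [reducedState, Matrix.conjTranspose_apply, Matrix.of_apply, star_sum]
  exact Finset.sum_congr rfl fun c _ => (densityMatrix_isHermitian A n).apply _ _

/-- The set of every `k`-th site of a chain of `n` spins. The label `j` is the spin number `j + 1`,
so these are the spins whose number is a multiple of `k`. -/
def everyKth (k n : ℕ) : Finset ℕ := (Finset.range n).filter fun j => k ∣ j + 1

/-- The Rényi-`α` entropy of `ρ_k^{(n)}`, the reduced state of every `k`-th spin. -/
noncomputable def entropyEveryKth (A : Fin d → Matrix (Fin D) (Fin D) ℂ) (α : ℝ≥0∞) (k n : ℕ) : ℝ :=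
  renyiEntropy (reducedState_isHermitian A n (everyKth k n)) α

/-- `liminf (k / n) S₂(ρ_k^{(n)})` as `n → ∞` through the multiples `n = k p` of `k`, taken in the
extended reals. -/
noncomputable def entropyDensity (A : Fin d → Matrix (Fin D) (Fin D) ℂ) (k : ℕ) : EReal :=
  Filter.liminf
    (fun p : ℕ => (((k : ℝ) / ((k * p : ℕ) : ℝ) * entropyEveryKth A 2 k (k * p) : ℝ) : EReal))
    Filter.atTop

/-- The transfer operator `T = ∑ᵢ Aⁱ ⊗ conj Aⁱ`, on two copies of the bond space. -/
noncomputable def transferOp (A : Fin d → Matrix (Fin D) (Fin D) ℂ) :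
    Matrix (Fin D × Fin D) (Fin D × Fin D) ℂ :=
  ∑ i, A i ⊗ₖ (A i).map star

/-- The completely positive map `X ↦ ∑ᵢ Aⁱ X (Aⁱ)†`. -/
noncomputable def cpMap (A : Fin d → Matrix (Fin D) (Fin D) ℂ) (X : Matrix (Fin D) (Fin D) ℂ) :
    Matrix (Fin D) (Fin D) ℂ :=
  ∑ i, A i * X * (A i).conjTranspose

/-- The Hilbert-Schmidt adjoint `X ↦ ∑ᵢ (Aⁱ)† X Aⁱ` of `cpMap A`. -/
noncomputable def cpMapAdjoint (A : Fin d → Matrix (Fin D) (Fin D) ℂ)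
    (X : Matrix (Fin D) (Fin D) ℂ) : Matrix (Fin D) (Fin D) ℂ :=
  ∑ i, (A i).conjTranspose * X * A i

/-- `T` is gapped with largest eigenvalue `t₁ > 0`: counted with algebraic multiplicity, `t₁` occurs
once and all other eigenvalues have modulus less than `t₁`. -/
def IsGapped {m : Type} [Fintype m] [DecidableEq m] (T : Matrix m m ℂ) (t₁ : ℝ) : Prop :=
  0 < t₁ ∧ ∃ s : Multiset ℂ, T.charpoly.roots = (t₁ : ℂ) ::ₘ s ∧ ∀ z ∈ s, ‖z‖ < t₁

/-- The partial swap `U = 1₁₃ ⊗ 𝔰₂₄` on four copies of the bond space. -/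
def partialSwap (D : ℕ) :
    Matrix ((Fin D × Fin D) × (Fin D × Fin D)) ((Fin D × Fin D) × (Fin D × Fin D)) ℂ :=
  Matrix.of fun x y => if x = ((y.1.1, y.2.2), (y.2.1, y.1.2)) then 1 else 0

/-- The twisted transfer operator `T̂_k = (T ⊗ T)^{k-1} U (T ⊗ T) U`. -/
noncomputable def twistedTransferOp (A : Fin d → Matrix (Fin D) (Fin D) ℂ) (k : ℕ) :
    Matrix ((Fin D × Fin D) × (Fin D × Fin D)) ((Fin D × Fin D) × (Fin D × Fin D)) ℂ :=
  (transferOp A ⊗ₖ transferOp A) ^ (k - 1) * partialSwap D *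
    (transferOp A ⊗ₖ transferOp A) * partialSwap D

/-- `z` is a greatest eigenvalue of `M`: an eigenvalue of largest modulus. -/
def IsTopEigenvalue {m : Type} [Fintype m] [DecidableEq m] (M : Matrix m m ℂ) (z : ℂ) : Prop :=
  Module.End.HasEigenvalue (Matrix.toLin' M) z ∧
    ∀ w : ℂ, Module.End.HasEigenvalue (Matrix.toLin' M) w → ‖w‖ ≤ ‖z‖

/-- A vector `|φ⟩ ⊗ |χ⟩` on two copies of the bond space. -/
def IsProductVector (v : Fin D × Fin D → ℂ) : Prop :=
  ∃ φ χ : Fin D → ℂ, v = fun x => φ x.1 * χ x.2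

/-- The canonical form of a translation-invariant MPS. There are nonzero, mutually orthogonal
projectors `P j` with sum `1` and `Aⁱ = ∑ⱼ λⱼ Bⁱ_{(j)}` with `λⱼ ≥ 0`, where `Bⁱ_{(j)}` lives on
block `j`, the projector `P j` is (up to scalars) the only fixed point of the completely positive
map of the block, and the adjoint map has a positive fixed point `Λ j` that vanishes on the
orthogonal complement of the block and has full rank on the block. -/
def IsCanonicalForm (A : Fin d → Matrix (Fin D) (Fin D) ℂ) : Prop :=
  ∃ (m : ℕ) (P : Fin m → Matrix (Fin D) (Fin D) ℂ) (lam : Fin m → ℝ)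
    (B : Fin m → Fin d → Matrix (Fin D) (Fin D) ℂ) (Λ : Fin m → Matrix (Fin D) (Fin D) ℂ),
    (∀ j, P j ≠ 0 ∧ (P j).IsHermitian ∧ P j * P j = P j) ∧
    (∀ j l, j ≠ l → P j * P l = 0) ∧
    ∑ j, P j = 1 ∧
    (∀ j, 0 ≤ lam j) ∧
    (∀ j i, P j * B j i * P j = B j i) ∧
    (∀ i, A i = ∑ j, (lam j : ℂ) • B j i) ∧
    (∀ j X, cpMap (B j) X = X ↔ ∃ c : ℂ, X = c • P j) ∧
    (∀ j, (Λ j).PosSemidef ∧ P j * Λ j * P j = Λ j ∧ (Λ j).rank = (P j).rank ∧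
      cpMapAdjoint (B j) (Λ j) = Λ j)

/-- The site-wise product `⨂_{x ∈ X} σ x`. -/
def productState (X : Finset ℕ) (σ : ℕ → Matrix (Fin d) (Fin d) ℂ) :
    Matrix (X → Fin d) (X → Fin d) ℂ :=
  Matrix.of fun a b => ∏ x : X, σ x (a x) (b x)

end MPS

/-!
Everything is expressed through the transfer operator `T`. Summing products of matrix elements over
configurations turns norms and partial traces into ordered products of transfer operators
(`sum_prod_ofFn`): the squared norm of the state vector is `tr (T ^ n)`, matrix elements of reduced
states are traces with `siteOp` inserted (`reducedState_apply`), and the purity of the state of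
every `k`-th spin of `n = k p` is `tr (T̂ₖ ^ p) / (tr (T ^ n)) ^ 2` (`sum_reducedState_everyKth`).

For the entropy density, `tr (T ^ n) → 1` by the gap, while `|tr (T̂ₖ ^ p)| ≤ const · |t̂₁| ^ p`,
with a matching lower bound for infinitely many `p`: the powers of the peripheral eigenvalues,
divided by their modulus, return arbitrarily late to a neighbourhood of `1`, where they cannot
cancel (`frequently_half_le_norm_sum_pow`). The spectral radius does not vanish since the purity is
positive.

For the equivalences, all states are invariant under gauge transformations, so that the tensor may
be taken in canonical form. The gap forces a block of weight one (`exists_isLeadingBlock`); its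
projector `P` spans the fixed points of the completely positive map, the fixed point `Λ` of the
adjoint map has full rank on it, and `T ^ n → |P)(Λ|`. Hence a leading eigenvector that is a product
vector, or a leading eigenoperator of rank one, means that `P` has rank one.

* If `P` has rank one, then `Aⁱ P = φᵢ P` with a unit vector `φ`. The difference between the state
  vector and `φ ⊗ ⋯ ⊗ φ` is the contribution of the other blocks, whose squared norm
  `tr ((Q ⊗ Q̄) T ^ n)`, `Q = 1 - P`, tends to zero (`tendsto_sum_norm_sq_sub`). The fidelity with
  the product vector bounds the purity of every reduced state, and thereby all Rényi entropies with
  `α > 1`, which vanish in the limit. Since `P` is a common eigenvector of all inserted operators,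
  the limit formula for reduced states gives products of `|φ⟩⟨φ|`.
* Conversely, a vanishing entropy density for arbitrarily large `k` and product limits of the
  reduced states both imply that the limiting one-site state, with matrix elements
  `tr (Λ Aⁱ P (Aʲ)†)`, is pure. In the first case, `T̂ₖ` converges as `k → ∞` to a matrix of rank
  one whose nonzero eigenvalue is the purity of that state, and having an eigenvalue of modulus one
  is a closed condition. In the second case, the purity of a product over `N` sites is the `N`-th
  power of the one-site purity, while it is at least `D ^ (-2)` because the state of an interval has
  rank at most `D ^ 2`.
  Finally, purity of the one-site state means that the matrices `Aⁱ P` are multiples of a single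
  one, and uniqueness of the fixed point makes `P` rank one (`rank_eq_one_of_one_le_purity`).
-/

namespace MPS

open Filter Matrix

variable {d D : ℕ}

/-! ### Powers of a complex matrix and its eigenvalues -/

theorem trace_pow_of_isNilpotent_sub {V : Type*} [AddCommGroup V] [Module ℂ V]
    [FiniteDimensional ℂ V] (g : Module.End ℂ V) (μ : ℂ)
    (hg : IsNilpotent (g - algebraMap ℂ (Module.End ℂ V) μ)) (p : ℕ) :
    LinearMap.trace ℂ V (g ^ p) = Module.finrank ℂ V * μ ^ p := by
  induction p with
  | zero => simp
  | succ q ih =>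
    have h := LinearMap.trace_comp_eq_mul_of_commute_of_isNilpotent μ
      ((Commute.refl g).pow_left q) hg
    rw [pow_succ, Module.End.mul_eq_comp, h, ih]
    ring

/-- The trace of `M ^ p` is the sum of the `p`-th powers of the eigenvalues of `M`, counted with
algebraic multiplicity: `M ^ p` has trace `dim V * μ ^ p` on the generalised eigenspace `V` of
`μ`. -/
theorem trace_pow_eq_sum_roots {m : Type} [Fintype m] [DecidableEq m] (M : Matrix m m ℂ) (p : ℕ) :
    (M ^ p).trace = (M.charpoly.roots.map (· ^ p)).sum := by
  set f : Module.End ℂ (m → ℂ) := Matrix.toLin' M with hf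
  have hcp : f.charpoly = M.charpoly := by rw [hf, ← Matrix.charpoly_toLin']
  have htr : (M ^ p).trace = LinearMap.trace ℂ _ (f ^ p) := by
    rw [hf, ← Matrix.toLin'_pow, Matrix.trace_toLin'_eq]
  have hmaps : ∀ μ, ∀ x ∈ f.maxGenEigenspace μ, (f ^ p) x ∈ f.maxGenEigenspace μ := fun μ x hx =>
    f.mapsTo_maxGenEigenspace_of_comm ((Commute.refl f).pow_right p) μ hx
  have hmap1 : ∀ μ, ∀ x ∈ f.maxGenEigenspace μ, f x ∈ f.maxGenEigenspace μ := fun μ x hx =>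
    f.mapsTo_maxGenEigenspace_of_comm (Commute.refl f) μ hx
  have hint : DirectSum.IsInternal fun μ => f.maxGenEigenspace μ :=
    DirectSum.isInternal_submodule_of_iSupIndep_of_iSup_eq_top f.independent_maxGenEigenspace
      (Module.End.iSup_maxGenEigenspace_eq_top f)
  have hfin : {μ | f.maxGenEigenspace μ ≠ ⊥}.Finite :=
    WellFoundedGT.finite_ne_bot_of_iSupIndep f.independent_maxGenEigenspace
  have hloc : ∀ μ, LinearMap.trace ℂ _ ((f ^ p).restrict (hmaps μ)) =
      M.charpoly.roots.count μ • μ ^ p := by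
    intro μ
    have h1 : (f ^ p).restrict (hmaps μ) = (f.restrict (hmap1 μ)) ^ p :=
      (Module.End.pow_restrict p (hmap1 μ)).symm
    rw [h1, trace_pow_of_isNilpotent_sub _ μ
      (f.isNilpotent_restrict_maxGenEigenspace_sub_algebraMap μ),
      LinearMap.finrank_maxGenEigenspace_eq, hcp, Polynomial.count_roots, nsmul_eq_mul]
  have hset : hfin.toFinset = M.charpoly.roots.toFinset := by
    ext μ
    rw [Set.Finite.mem_toFinset, Set.mem_ofPred_eq, Multiset.mem_toFinset, ← Multiset.count_pos,
      Polynomial.count_roots, ← hcp, ← LinearMap.finrank_maxGenEigenspace_eq, Ne,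
      ← Submodule.finrank_eq_zero (R := ℂ), Nat.pos_iff_ne_zero]
  rw [htr, LinearMap.trace_eq_sum_trace_restrict' hint hfin hmaps, Finset.sum_multiset_map_count,
    hset]
  exact Finset.sum_congr rfl fun μ _ => hloc μ

/-- Powers of finitely many complex numbers of modulus at most one return arbitrarily late to a
position where all those of modulus one are close to `1` (recurrence in a compact group); hence, if
at least one has modulus one, the power sums do not become small. -/
theorem frequently_half_le_norm_sum_pow (s : Multiset ℂ) (hs : ∀ z ∈ s, ‖z‖ ≤ 1)
    (h1 : ∃ z ∈ s, ‖z‖ = 1) : ∃ᶠ p in atTop, 1 / 2 ≤ ‖(s.map (· ^ p)).sum‖ := by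
  classical
  obtain ⟨z₀, hz₀, hn₀⟩ := h1
  obtain ⟨s', rfl⟩ := Multiset.exists_cons_of_mem hz₀
  -- small enough for `s'.card` terms of real part at least `-ε` to cost at most `1 / 4`
  set ε : ℝ := 1 / (4 * (s'.card + 1)) with hε
  have hεpos : 0 < ε := by positivity
  have hε4 : ε ≤ 1 / 4 := by
    rw [hε, div_le_div_iff_of_pos_left one_pos (by positivity) (by norm_num)]
    have : (0 : ℝ) ≤ s'.card := by positivity
    linarith
  -- the unimodular numbers, as a point of a product of circles
  let u : ℂ → Circle := fun z =>
    if h : ‖z‖ = 1 then ⟨z, by simpa [Submonoid.unitSphere] using h⟩ else 1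
  have hu : ∀ z, ‖z‖ = 1 → (u z : ℂ) = z := fun z h => by simp [u, h]
  have hnhds : {w : ℂ → Circle | ∀ z ∈ (z₀ ::ₘ s').toFinset, ‖(w z : ℂ) - 1‖ < ε} ∈
      𝓝 (1 : ℂ → Circle) := by
    have : ∀ z ∈ (z₀ ::ₘ s').toFinset, ∀ᶠ w : ℂ → Circle in 𝓝 1, ‖(w z : ℂ) - 1‖ < ε := by
      intro z _
      have hc : Continuous fun w : ℂ → Circle => ‖(w z : ℂ) - 1‖ := by fun_prop
      have := hc.tendsto 1
      simp only [Pi.one_apply, Circle.coe_one, sub_self, norm_zero] at this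
      exact this.eventually (gt_mem_nhds hεpos)
    exact (Finset.eventually_all _).2 this
  have hfreq : ∃ᶠ p in atTop, u ^ p ∈
      {w : ℂ → Circle | ∀ z ∈ (z₀ ::ₘ s').toFinset, ‖(w z : ℂ) - 1‖ < ε} :=
    (mapClusterPt_one_atTop_pow u).frequently hnhds
  have hev : ∀ᶠ p : ℕ in atTop, ∀ z ∈ (z₀ ::ₘ s').toFinset, ‖z‖ < 1 → ‖z ^ p‖ < ε := by
    refine (Finset.eventually_all _).2 fun z _ => ?_
    by_cases hz : ‖z‖ < 1
    · have := (tendsto_pow_atTop_nhds_zero_of_norm_lt_one hz).norm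
      rw [norm_zero] at this
      filter_upwards [this.eventually (gt_mem_nhds hεpos)] with p hp _ using hp
    · exact Eventually.of_forall fun p h => absurd h hz
  refine (hfreq.and_eventually hev).mono fun p hp => ?_
  obtain ⟨hp1, hp2⟩ := hp
  have key : ∀ z ∈ z₀ ::ₘ s', ‖z‖ = 1 → ‖z ^ p - 1‖ < ε := by
    intro z hz h
    have := hp1 z (Multiset.mem_toFinset.2 hz)
    simpa [hu z h] using this
  have hlow : ∀ z ∈ z₀ ::ₘ s', -ε ≤ (z ^ p).re := by
    intro z hz
    rcases (hs z hz).lt_or_eq with h | h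
    · have h2 := hp2 z (Multiset.mem_toFinset.2 hz) h
      have := Complex.abs_re_le_norm (z ^ p)
      linarith [abs_le.1 this]
    · have h2 := key z hz h
      have := Complex.abs_re_le_norm (z ^ p - 1)
      simp only [Complex.sub_re, Complex.one_re] at this
      linarith [(abs_le.1 this).1]
  have hz : 3 / 4 ≤ (z₀ ^ p).re := by
    have h2 := key z₀ hz₀ hn₀
    have := Complex.abs_re_le_norm (z₀ ^ p - 1)
    simp only [Complex.sub_re, Complex.one_re] at this
    linarith [(abs_le.1 this).1]
  have hsum : s'.card • (-ε) ≤ ((s'.map (· ^ p)).map Complex.re).sum := by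
    have := Multiset.card_nsmul_le_sum (s := (s'.map (· ^ p)).map Complex.re) (a := -ε) (by
      simp only [Multiset.mem_map, forall_exists_index, and_imp, forall_apply_eq_imp_iff₂]
      exact fun z hz => hlow z (Multiset.mem_cons_of_mem hz))
    simpa using this
  have hre : (((s'.map (· ^ p)).sum).re) = ((s'.map (· ^ p)).map Complex.re).sum :=
    map_multiset_sum Complex.reAddGroupHom _
  have hcard : (s'.card : ℝ) * ε ≤ 1 / 4 := by
    rw [hε, mul_one_div, div_le_div_iff₀ (by positivity) (by norm_num)]
    linarith
  refine le_trans ?_ (Complex.re_le_norm _)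
  rw [Multiset.map_cons, Multiset.sum_cons, Complex.add_re, hre]
  rw [nsmul_eq_mul] at hsum
  linarith

theorem exists_isTopEigenvalue {m : Type} [Fintype m] [DecidableEq m] [Nonempty m]
    (M : Matrix m m ℂ) : ∃ t, IsTopEigenvalue M t := by
  have hr : ∀ w, w ∈ M.charpoly.roots ↔ Module.End.HasEigenvalue (Matrix.toLin' M) w := fun w => by
    rw [Module.End.hasEigenvalue_iff_isRoot_charpoly, Matrix.charpoly_toLin',
      Polynomial.mem_roots M.charpoly_monic.ne_zero]
  have hne : M.charpoly.roots.toFinset.Nonempty := by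
    obtain ⟨c, hc⟩ := Module.End.exists_eigenvalue (Matrix.toLin' M)
    exact ⟨c, Multiset.mem_toFinset.2 ((hr c).2 hc)⟩
  obtain ⟨t, ht, hmax⟩ := Finset.exists_max_image _ (fun z => ‖z‖) hne
  exact ⟨t, (hr t).1 (Multiset.mem_toFinset.1 ht),
    fun w hw => hmax w (Multiset.mem_toFinset.2 ((hr w).2 hw))⟩

/-- The powers of a matrix whose eigenvalues all have modulus less than one tend to zero
(Gelfand's formula). -/
theorem tendsto_pow_zero_of_eigenvalue_lt_one {m : Type} [Fintype m] [DecidableEq m]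
    (M : Matrix m m ℂ) (h : ∀ z : ℂ, ∀ v : m → ℂ, v ≠ 0 → M *ᵥ v = z • v → ‖z‖ < 1) :
    Tendsto (fun n : ℕ => M ^ n) atTop (𝓝 0) := by
  rcases isEmpty_or_nonempty m with hm | hm
  · have : (fun n : ℕ => M ^ n) = fun _ => 0 := by
      funext n; ext i; exact hm.elim i
    rw [this]; exact tendsto_const_nhds
  let := Matrix.linftyOpNormedRing (n := m) (α := ℂ)
  let := Matrix.linftyOpNormedAlgebra (n := m) (α := ℂ) (R := ℂ)
  have hs : spectralRadius ℂ M < (1 : NNReal) := by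
    refine spectrum.spectralRadius_lt_of_forall_lt M fun z hz => ?_
    rw [Matrix.mem_spectrum_iff_isRoot_charpoly, ← Matrix.charpoly_toLin',
      ← Module.End.hasEigenvalue_iff_isRoot_charpoly] at hz
    obtain ⟨v, hv⟩ := hz.exists_hasEigenvector
    exact h z v hv.2 (by simpa using hv.apply_eq_smul)
  obtain ⟨r, hr1, hr2⟩ := ENNReal.lt_iff_exists_nnreal_btwn.1 hs
  have hr2' : (r : ℝ) < 1 := by exact_mod_cast hr2
  have hev : ∀ᶠ n : ℕ in atTop, ‖M ^ n‖ ≤ (r : ℝ) ^ n := by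
    filter_upwards [(spectrum.pow_nnnorm_pow_one_div_tendsto_nhds_spectralRadius M).eventually
      (gt_mem_nhds hr1), eventually_gt_atTop 0] with n hn hn0
    have hn' : (n : ℝ) ≠ 0 := by positivity
    have h2 := ENNReal.rpow_le_rpow hn.le (n.cast_nonneg : (0 : ℝ) ≤ n)
    rw [← ENNReal.rpow_mul, one_div_mul_cancel hn', ENNReal.rpow_one, ENNReal.rpow_natCast] at h2
    exact_mod_cast h2
  have hlim : Tendsto (fun n : ℕ => ‖M ^ n‖) atTop (𝓝 0) :=
    squeeze_zero' (Eventually.of_forall fun n => norm_nonneg _) hev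
      (tendsto_pow_atTop_nhds_zero_of_lt_one r.2 hr2')
  refine tendsto_pi_nhds.2 fun i => tendsto_pi_nhds.2 fun j => ?_
  refine squeeze_zero_norm (fun n => ?_) hlim
  change ‖(M ^ n) i j‖₊ ≤ ‖M ^ n‖₊
  rw [Matrix.linfty_opNNNorm_def]
  exact (Finset.single_le_sum (f := fun j => ‖(M ^ n) i j‖₊) (fun _ _ => zero_le)
    (Finset.mem_univ j)).trans (Finset.le_sup (f := fun i => ∑ j, ‖(M ^ n) i j‖₊)
      (Finset.mem_univ i))

/-- The geometric multiplicity of the leading eigenvalue is at most its algebraic multiplicity,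
which is one. -/
theorem IsGapped.eigenvector_unique {m : Type} [Fintype m] [DecidableEq m] {T : Matrix m m ℂ}
    (hT : IsGapped T 1) {r v : m → ℂ} (hr0 : r ≠ 0) (hr : T *ᵥ r = r) (hv : T *ᵥ v = v) :
    ∃ c : ℂ, v = c • r := by
  obtain ⟨-, s, hs, hlt⟩ := hT
  have hone : (1 : ℂ) ∉ s := fun h => by simpa using hlt 1 h
  have hmult : (LinearMap.charpoly (Matrix.toLin' T)).rootMultiplicity 1 = 1 := by
    rw [Matrix.charpoly_toLin', ← Polynomial.count_roots, hs]
    simp [hone]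
  have hle := LinearMap.finrank_eigenspace_le (Matrix.toLin' T) 1
  rw [hmult] at hle
  have hmem : ∀ x, T *ᵥ x = x → x ∈ Module.End.eigenspace (Matrix.toLin' T) 1 := fun x hx => by
    rw [Module.End.mem_eigenspace_iff]; simpa using hx
  have hle' : Module.finrank ℂ (Module.End.eigenspace (Matrix.toLin' T) 1) = 1 := by
    refine le_antisymm hle (Nat.one_le_iff_ne_zero.2 fun h0 => hr0 ?_)
    have := Submodule.finrank_eq_zero.1 h0
    simpa [this] using hmem r hr
  obtain ⟨c, hc⟩ := (finrank_eq_one_iff_of_nonzero' (⟨r, hmem r hr⟩ :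
    Module.End.eigenspace (Matrix.toLin' T) 1) (by simpa using hr0)).1 hle' ⟨v, hmem v hv⟩
  exact ⟨c, by simpa using (congrArg Subtype.val hc).symm⟩

theorem IsGapped.norm_le_one {m : Type} [Fintype m] [DecidableEq m] {T : Matrix m m ℂ}
    (hT : IsGapped T 1) {v : m → ℂ} {z : ℂ} (hv0 : v ≠ 0) (hv : T *ᵥ v = z • v) :
    z = 1 ∨ ‖z‖ < 1 := by
  obtain ⟨-, s, hs, hlt⟩ := hT
  have hz : z ∈ T.charpoly.roots := by
    rw [Polynomial.mem_roots T.charpoly_monic.ne_zero, ← Matrix.charpoly_toLin',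
      ← Module.End.hasEigenvalue_iff_isRoot_charpoly]
    exact Module.End.hasEigenvalue_of_hasEigenvector
      ⟨Module.End.mem_eigenspace_iff.2 (by simpa using hv), hv0⟩
  rw [hs, Multiset.mem_cons] at hz
  exact hz.imp (by simp) (hlt z)

/-- The powers of a gapped matrix converge to the rank-one projector on its leading eigenvector. -/
theorem IsGapped.tendsto_pow {m : Type} [Fintype m] [DecidableEq m] {T : Matrix m m ℂ}
    (hT : IsGapped T 1) {r l : m → ℂ} (hr : T *ᵥ r = r) (hl : l ᵥ* T = l) (hlr : l ⬝ᵥ r = 1) :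
    Tendsto (fun n : ℕ => T ^ n) atTop (𝓝 (vecMulVec r l)) := by
  set Q := vecMulVec r l with hQ
  have hQQ : Q * Q = Q := by
    rw [hQ, vecMulVec_mul_vecMulVec, hlr, one_smul]
  have hTQ : T * Q = Q := by rw [hQ, mul_vecMulVec, hr]
  have hQT : Q * T = Q := by rw [hQ, vecMulVec_mul, hl]
  have hr0 : r ≠ 0 := fun h => by simp [h] at hlr
  have hpow : ∀ n : ℕ, (T - Q) ^ (n + 1) = T ^ (n + 1) - Q := by
    intro n
    induction n with
    | zero => simp
    | succ k ih =>
      have hTkQ : T ^ (k + 1) * Q = Q := by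
        clear ih
        induction k with
        | zero => simpa using hTQ
        | succ k ih => rw [pow_succ, mul_assoc, hTQ, ih]
      rw [pow_succ, ih, mul_sub, sub_mul, sub_mul, hTkQ, hQT, hQQ, sub_self, sub_zero,
        ← pow_succ]
  have h0 : Tendsto (fun n : ℕ => (T - Q) ^ n) atTop (𝓝 0) := by
    refine tendsto_pow_zero_of_eigenvalue_lt_one _ fun z v hv0 hv => ?_
    rcases eq_or_ne z 0 with rfl | hz
    · simp
    have hQv : Q *ᵥ v = 0 := by
      have h1 : Q *ᵥ ((T - Q) *ᵥ v) = 0 := by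
        rw [mulVec_mulVec, mul_sub, hQT, hQQ, sub_self, zero_mulVec]
      rw [hv, mulVec_smul] at h1
      exact (smul_eq_zero.1 h1).resolve_left hz
    have hTv : T *ᵥ v = z • v := by rw [← hv, sub_mulVec, hQv, sub_zero]
    refine (hT.norm_le_one hv0 hTv).resolve_left fun h1 => hv0 ?_
    obtain ⟨c, rfl⟩ := hT.eigenvector_unique hr0 hr (by rw [hTv, h1, one_smul])
    have : l ⬝ᵥ (c • r) = c := by rw [dotProduct_smul, hlr, smul_eq_mul, mul_one]
    rw [hQ, vecMulVec_mulVec, this] at hQv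
    simpa using hQv
  have h1 : Tendsto (fun n : ℕ => (T - Q) ^ (n + 1) + Q) atTop (𝓝 (0 + Q)) :=
    ((tendsto_add_atTop_iff_nat 1).2 h0).add tendsto_const_nhds
  rw [zero_add] at h1
  refine (tendsto_add_atTop_iff_nat 1).1 (h1.congr fun n => ?_)
  rw [hpow, sub_add_cancel]

theorem IsGapped.tendsto_trace_pow {m : Type} [Fintype m] [DecidableEq m] {T : Matrix m m ℂ}
    (hT : IsGapped T 1) : Tendsto (fun n : ℕ => (T ^ n).trace) atTop (𝓝 1) := by
  obtain ⟨-, s, hs, hlt⟩ := hT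
  have h : Tendsto (fun n : ℕ => (s.map (· ^ n)).sum) atTop (𝓝 0) := by
    clear hs
    induction s using Multiset.induction with
    | empty => simp
    | cons z s ih =>
      simp only [Multiset.map_cons, Multiset.sum_cons]
      simpa using (tendsto_pow_atTop_nhds_zero_of_norm_lt_one
        (hlt z (Multiset.mem_cons_self z s))).add
          (ih fun w hw => hlt w (Multiset.mem_cons_of_mem hw))
  have h1 := h.const_add 1
  rw [add_zero] at h1
  refine h1.congr fun n => ?_
  rw [trace_pow_eq_sum_roots, hs]
  simp

theorem norm_trace_pow_le {m : Type} [Fintype m] [DecidableEq m] {M : Matrix m m ℂ} {t : ℂ}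
    (ht : IsTopEigenvalue M t) (p : ℕ) : ‖(M ^ p).trace‖ ≤ Fintype.card m * ‖t‖ ^ p := by
  have hroot : ∀ z ∈ M.charpoly.roots, ‖z‖ ≤ ‖t‖ := fun z hz => by
    refine ht.2 z ?_
    rwa [Module.End.hasEigenvalue_iff_isRoot_charpoly, Matrix.charpoly_toLin',
      ← Polynomial.mem_roots M.charpoly_monic.ne_zero]
  have hcard : M.charpoly.roots.card ≤ Fintype.card m := by
    rw [← Matrix.charpoly_natDegree_eq_dim M]
    exact Polynomial.card_roots' _
  have h1 : ‖(M.charpoly.roots.map (· ^ p)).sum‖ ≤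
      ((M.charpoly.roots.map (· ^ p)).map fun z => ‖z‖).sum :=
    norm_multiset_sum_le _
  have h2 : ((M.charpoly.roots.map (· ^ p)).map fun z => ‖z‖).sum ≤
      M.charpoly.roots.card • ‖t‖ ^ p := by
    have := Multiset.sum_le_card_nsmul ((M.charpoly.roots.map (· ^ p)).map fun z => ‖z‖)
      (‖t‖ ^ p) (by
        simp only [Multiset.map_map, Multiset.mem_map, Function.comp_apply, forall_exists_index,
          and_imp, forall_apply_eq_imp_iff₂, norm_pow]
        exact fun z hz => pow_le_pow_left₀ (norm_nonneg _) (hroot z hz) p)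
    simpa using this
  rw [trace_pow_eq_sum_roots]
  refine (h1.trans h2).trans ?_
  rw [nsmul_eq_mul]
  gcongr

theorem frequently_le_norm_trace_pow {m : Type} [Fintype m] [DecidableEq m] {M : Matrix m m ℂ}
    {t : ℂ} (ht : IsTopEigenvalue M t) (ht0 : t ≠ 0) :
    ∃ᶠ p in atTop, 1 / 2 * ‖t‖ ^ p ≤ ‖(M ^ p).trace‖ := by
  have hr : ∀ w, w ∈ M.charpoly.roots ↔ Module.End.HasEigenvalue (Matrix.toLin' M) w := fun w => by
    rw [Module.End.hasEigenvalue_iff_isRoot_charpoly, Matrix.charpoly_toLin',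
      Polynomial.mem_roots M.charpoly_monic.ne_zero]
  have htn : 0 < ‖t‖ := norm_pos_iff.2 ht0
  have h := frequently_half_le_norm_sum_pow (M.charpoly.roots.map (· / t))
    (by
      simp only [Multiset.mem_map, forall_exists_index, and_imp, forall_apply_eq_imp_iff₂, norm_div]
      exact fun z hz => (div_le_one htn).2 (ht.2 z ((hr z).1 hz)))
    ⟨1, Multiset.mem_map.2 ⟨t, (hr t).2 ht.1, div_self ht0⟩, norm_one⟩
  refine h.mono fun p hp => ?_
  have hsum : ((M.charpoly.roots.map (· / t)).map (· ^ p)).sum = (M ^ p).trace / t ^ p := by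
    rw [trace_pow_eq_sum_roots, ← Multiset.sum_map_div, Multiset.map_map]
    simp [div_pow]
  rw [hsum, norm_div, norm_pow, le_div_iff₀ (by positivity)] at hp
  exact hp

/-- If a positive sequence `q p` is asymptotically `|tr (M ^ p)|`, then its exponential decay rate
is governed by the largest modulus of an eigenvalue of `M`. The limit need not exist, since the
traces may oscillate. -/
theorem liminf_neg_log_div_eq {m : Type} [Fintype m] [DecidableEq m] {M : Matrix m m ℂ}
    {t : ℂ} (ht : IsTopEigenvalue M t) (ht0 : t ≠ 0) {q c : ℕ → ℝ} (hc : Tendsto c atTop (𝓝 1))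
    (hq : ∀ᶠ p in atTop, 0 < q p ∧ q p * c p = ‖(M ^ p).trace‖) :
    liminf (fun p : ℕ => ((-Real.log (q p) / p : ℝ) : EReal)) atTop =
      ((-Real.log ‖t‖ : ℝ) : EReal) := by
  have htn : 0 < ‖t‖ := norm_pos_iff.2 ht0
  have hc1 : ∀ᶠ p in atTop, 1 / 2 < c p := hc.eventually (lt_mem_nhds (by norm_num))
  have hc2 : ∀ᶠ p in atTop, c p < 2 := hc.eventually (gt_mem_nhds (by norm_num))
  have hcorr : ∀ a : ℝ, Tendsto (fun p : ℕ => a / p - Real.log ‖t‖) atTop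
      (𝓝 (-Real.log ‖t‖)) := fun a => by
    simpa using (tendsto_const_div_atTop_nhds_zero_nat a).sub_const (Real.log ‖t‖)
  have hlogpow : ∀ (a : ℝ), 0 < a → ∀ p : ℕ, 0 < p →
      -Real.log (a * ‖t‖ ^ p) / p = -Real.log a / p - Real.log ‖t‖ := fun a ha p hp => by
    rw [Real.log_mul ha.ne' (by positivity), Real.log_pow]
    field_simp
    ring
  apply le_antisymm
  · by_contra! hlt
    obtain ⟨b, hb1, hb2⟩ := EReal.lt_iff_exists_real_btwn.1 hlt
    have hev := eventually_lt_of_lt_liminf hb2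
    have hb1' := EReal.coe_lt_coe_iff.1 hb1
    obtain ⟨p, ⟨⟨⟨⟨⟨hp1, hp2⟩, hp3⟩, hp4⟩, hp5⟩, hp6⟩⟩ :=
      (((((frequently_le_norm_trace_pow ht ht0).and_eventually hev).and_eventually
        hq).and_eventually hc2).and_eventually
          ((hcorr (-Real.log (1 / 4))).eventually (gt_mem_nhds hb1'))
        |>.and_eventually (eventually_gt_atTop 0)).exists
    have hp2' := EReal.coe_lt_coe_iff.1 hp2
    have hle : 1 / 4 * ‖t‖ ^ p ≤ q p := by
      have : q p * c p ≤ q p * 2 := mul_le_mul_of_nonneg_left hp4.le hp3.1.le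
      rw [hp3.2] at this
      linarith
    have : -Real.log (q p) / p ≤ -Real.log (1 / 4 * ‖t‖ ^ p) / p := by
      gcongr
    rw [hlogpow _ (by norm_num) p hp6] at this
    linarith
  · have hm : (0 : ℝ) < 2 * (Fintype.card m + 1) := by positivity
    have hlim : Tendsto (fun p : ℕ =>
        ((-Real.log (2 * (Fintype.card m + 1)) / p - Real.log ‖t‖ : ℝ) : EReal)) atTop
        (𝓝 ((-Real.log ‖t‖ : ℝ) : EReal)) := EReal.tendsto_coe.2 (hcorr _)
    rw [← hlim.liminf_eq]
    refine liminf_le_liminf ?_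
    filter_upwards [hq, hc1, eventually_gt_atTop 0] with p hp hp1 hp0
    rw [EReal.coe_le_coe_iff, ← hlogpow _ hm p hp0]
    have hle : q p ≤ 2 * (Fintype.card m + 1) * ‖t‖ ^ p := by
      have h1 : q p * (1 / 2) ≤ q p * c p := mul_le_mul_of_nonneg_left hp1.le hp.1.le
      rw [hp.2] at h1
      have h2 := norm_trace_pow_le ht p
      have h3 : 0 < ‖t‖ ^ p := by positivity
      nlinarith
    have := hp.1
    gcongr

/-! ### Sums over configurations as products of transfer operators -/

/-- Distributivity for an ordered product of sums in a noncommutative semiring. -/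
theorem sum_piFinset_prod_ofFn {R ι : Type*} [Semiring R] [DecidableEq ι] (n : ℕ)
    (t : Fin n → Finset ι) (M : Fin n → ι → R) :
    ∑ s ∈ Fintype.piFinset t, (List.ofFn fun j => M j (s j)).prod =
      (List.ofFn fun j => ∑ i ∈ t j, M j i).prod := by
  induction n with
  | zero => simp
  | succ n ih =>
    have h : ∑ s ∈ Fintype.piFinset t, (List.ofFn fun j => M j (s j)).prod =
        ∑ x ∈ t 0 ×ˢ Fintype.piFinset (Fin.tail t),
          M 0 x.1 * (List.ofFn fun j : Fin n => M j.succ (x.2 j)).prod := by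
      refine Finset.sum_nbij' (fun s => (s 0, Fin.tail s)) (fun x => Fin.cons x.1 x.2)
        ?_ ?_ ?_ ?_ ?_
      · intro s hs
        rw [Fin.mem_piFinset_iff_zero_tail] at hs
        exact Finset.mem_product.2 hs
      · intro x hx
        rw [Fin.mem_piFinset_iff_zero_tail]
        simpa using hx
      · intro s _; simp
      · intro x _; simp
      · intro s _; simp [Fin.tail]
    rw [h, Finset.sum_product, List.ofFn_succ, List.prod_cons, ← ih, Finset.sum_mul_sum]
    rfl

theorem sum_prod_ofFn {R ι : Type*} [Semiring R] [Fintype ι] (n : ℕ) (M : Fin n → ι → R) :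
    ∑ s : Fin n → ι, (List.ofFn fun j => M j (s j)).prod =
      (List.ofFn fun j => ∑ i, M j i).prod := by
  classical
  rw [← sum_piFinset_prod_ofFn, Fintype.piFinset_univ]

theorem prod_ofFn_kronecker {m m' : Type} [Fintype m] [DecidableEq m] [Fintype m'] [DecidableEq m']
    {n : ℕ} (f : Fin n → Matrix m m ℂ) (g : Fin n → Matrix m' m' ℂ) :
    (List.ofFn f).prod ⊗ₖ (List.ofFn g).prod = (List.ofFn fun j => f j ⊗ₖ g j).prod := by
  induction n with
  | zero => simp
  | succ n ih =>
    simp only [List.ofFn_succ, List.prod_cons, ← ih, mul_kronecker_mul]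

theorem prod_ofFn_map_star {m : Type} [Fintype m] [DecidableEq m] {n : ℕ}
    (f : Fin n → Matrix m m ℂ) :
    (List.ofFn f).prod.map star = (List.ofFn fun j => (f j).map star).prod := by
  induction n with
  | zero => simp
  | succ n ih =>
    simp only [List.ofFn_succ, List.prod_cons, ← ih]
    exact Matrix.map_mul (f := starRingEnd ℂ)

theorem trace_map_star {m : Type} [Fintype m] (M : Matrix m m ℂ) :
    (M.map star).trace = star M.trace := by
  simp [Matrix.trace]

theorem kronecker_pow' {m m' : Type} [Fintype m] [DecidableEq m] [Fintype m'] [DecidableEq m']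
    (M : Matrix m m ℂ) (N : Matrix m' m' ℂ) (n : ℕ) : (M ⊗ₖ N) ^ n = (M ^ n) ⊗ₖ (N ^ n) := by
  induction n with
  | zero => simp
  | succ n ih => rw [pow_succ, ih, ← mul_kronecker_mul, ← pow_succ, ← pow_succ]

/-- The transfer operator with the physical operator `|i⟩⟨j|` inserted. -/
noncomputable def siteOp (A : Fin d → Matrix (Fin D) (Fin D) ℂ) (i j : Fin d) :
    Matrix (Fin D × Fin D) (Fin D × Fin D) ℂ :=
  A i ⊗ₖ (A j).map star

theorem stateVector_mul_star (A : Fin d → Matrix (Fin D) (Fin D) ℂ) {n : ℕ} (s s' : Fin n → Fin d) :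
    stateVector A n s * star (stateVector A n s') =
      (List.ofFn fun j => siteOp A (s j) (s' j)).prod.trace := by
  have h : star (stateVector A n s') = ((List.ofFn fun j => A (s' j)).prod.map star).trace := by
    rw [trace_map_star, stateVector]
  rw [h, stateVector, ← trace_kronecker, prod_ofFn_map_star, prod_ofFn_kronecker]
  rfl

/-- The squared norm of the state vector is the trace of a power of the transfer operator. -/
theorem star_dotProduct_stateVector (A : Fin d → Matrix (Fin D) (Fin D) ℂ) (n : ℕ) :
    star (stateVector A n) ⬝ᵥ stateVector A n = (transferOp A ^ n).trace := by
  have h : transferOp A ^ n = (List.ofFn fun _ : Fin n => ∑ i, siteOp A i i).prod := by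
    simp [List.ofFn_const, transferOp, siteOp]
  rw [h, ← sum_prod_ofFn n fun _ i => siteOp A i i, trace_sum, dotProduct]
  refine Finset.sum_congr rfl fun s _ => ?_
  rw [← stateVector_mul_star, mul_comm]
  rfl

theorem densityMatrix_apply (A : Fin d → Matrix (Fin D) (Fin D) ℂ) {n : ℕ} (s s' : Fin n → Fin d) :
    densityMatrix A n s s' = (transferOp A ^ n).trace⁻¹ *
      (stateVector A n s * star (stateVector A n s')) := by
  simp [densityMatrix, star_dotProduct_stateVector, vecMulVec_apply]

/-- The matrix elements of a reduced state in terms of transfer operators: sites outside `X`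
contribute the transfer operator itself. -/
theorem reducedState_apply (A : Fin d → Matrix (Fin D) (Fin D) ℂ) (n : ℕ) (X : Finset ℕ)
    (a b : X → Fin d) :
    reducedState A n X a b = (transferOp A ^ n).trace⁻¹ *
      (List.ofFn fun j : Fin n => if h : (j : ℕ) ∈ X then siteOp A (a ⟨j, h⟩) (b ⟨j, h⟩)
        else transferOp A).prod.trace := by
  simp only [reducedState, of_apply, densityMatrix_apply, ← Finset.mul_sum]
  congr 1
  let t : Fin n → Finset (Fin d) := fun j =>
    if h : (j : ℕ) ∈ X then {a ⟨j, h⟩} else Finset.univ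
  let M : Fin n → Fin d → Matrix (Fin D × Fin D) (Fin D × Fin D) ℂ := fun j i =>
    siteOp A i (if h : (j : ℕ) ∈ X then b ⟨j, h⟩ else i)
  have h1 : (List.ofFn fun j : Fin n => if h : (j : ℕ) ∈ X then siteOp A (a ⟨j, h⟩) (b ⟨j, h⟩)
      else transferOp A) = List.ofFn fun j => ∑ i ∈ t j, M j i := by
    congr 1
    funext j
    by_cases h : (j : ℕ) ∈ X
    · simp [t, M, h]
    · simp [t, M, h, transferOp, siteOp]
  rw [h1, ← sum_piFinset_prod_ofFn, trace_sum]
  refine Finset.sum_bij' (fun c _ => glue a c) (fun s _ => fun j => s j) ?_ ?_ ?_ ?_ ?_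
  · intro c _
    refine Fintype.mem_piFinset.2 fun j => ?_
    by_cases h : (j : ℕ) ∈ X <;> simp [t, glue, h]
  · intro s _; exact Finset.mem_univ _
  · intro c _
    funext j
    simp [glue, j.2]
  · intro s hs
    funext j
    have := Fintype.mem_piFinset.1 hs j
    by_cases h : (j : ℕ) ∈ X
    · simp only [t, h, dite_true, Finset.mem_singleton] at this
      simp [glue, h, this]
    · simp [glue, h]
  · intro c _
    rw [stateVector_mul_star]
    congr 3
    funext j
    by_cases h : (j : ℕ) ∈ X <;> simp [M, glue, h]

/-- A configuration of the chain is the same as a configuration of the sites in `X` and one of the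
other sites. -/
def glueEquiv {n : ℕ} {X : Finset ℕ} (hX : X ⊆ Finset.range n) :
    (X → Fin d) × ({j : Fin n // (j : ℕ) ∉ X} → Fin d) ≃ (Fin n → Fin d) where
  toFun x := glue x.1 x.2
  invFun s := (fun x => s ⟨x, Finset.mem_range.1 (hX x.2)⟩, fun j => s j)
  left_inv x := by
    refine Prod.ext ?_ ?_
    · funext y; simp [glue]
    · funext j; simp [glue, j.2]
  right_inv s := by
    funext j
    by_cases h : (j : ℕ) ∈ X <;> simp [glue, h]

theorem sum_eq_sum_glue {E : Type*} [AddCommMonoid E] {n : ℕ} {X : Finset ℕ}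
    (hX : X ⊆ Finset.range n) (f : (Fin n → Fin d) → E) :
    ∑ s, f s = ∑ a : X → Fin d, ∑ c : {j : Fin n // (j : ℕ) ∉ X} → Fin d, f (glue a c) := by
  rw [← Fintype.sum_prod_type']
  exact (Fintype.sum_equiv (glueEquiv hX) _ _ fun _ => rfl).symm

theorem trace_reducedState (A : Fin d → Matrix (Fin D) (Fin D) ℂ) {n : ℕ} {X : Finset ℕ}
    (hX : X ⊆ Finset.range n) (h0 : (transferOp A ^ n).trace ≠ 0) :
    (reducedState A n X).trace = 1 := by
  simp only [Matrix.trace, diag_apply, reducedState, of_apply]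
  rw [← sum_eq_sum_glue hX fun s => densityMatrix A n s s]
  simp only [densityMatrix_apply, ← Finset.mul_sum]
  have := star_dotProduct_stateVector A n
  rw [dotProduct] at this
  simp only [mul_comm (stateVector A n _)]
  erw [this]
  exact inv_mul_cancel₀ h0

/-- The two-copy transfer operator with the second and fourth bond copies exchanged is the sum over
the doubled physical index of a site that is kept in the reduced state. -/
theorem partialSwap_conj (A : Fin d → Matrix (Fin D) (Fin D) ℂ) :
    partialSwap D * (transferOp A ⊗ₖ transferOp A) * partialSwap D =
      ∑ i, ∑ j, siteOp A i j ⊗ₖ siteOp A j i := by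
  ext ⟨⟨x1, x2⟩, ⟨x3, x4⟩⟩ ⟨⟨y1, y2⟩, ⟨y3, y4⟩⟩
  have hl : ∀ M : Matrix ((Fin D × Fin D) × (Fin D × Fin D)) ((Fin D × Fin D) × (Fin D × Fin D)) ℂ,
      ∀ x y, (partialSwap D * M) x y = M ((x.1.1, x.2.2), (x.2.1, x.1.2)) y := by
    intro M x y
    rw [Matrix.mul_apply, Finset.sum_eq_single ((x.1.1, x.2.2), (x.2.1, x.1.2))]
    · simp [partialSwap]
    · intro z _ hz
      rw [partialSwap, of_apply, if_neg, zero_mul]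
      rintro rfl
      exact hz rfl
    · simp
  have hr : ∀ M : Matrix ((Fin D × Fin D) × (Fin D × Fin D)) ((Fin D × Fin D) × (Fin D × Fin D)) ℂ,
      ∀ x y, (M * partialSwap D) x y = M x ((y.1.1, y.2.2), (y.2.1, y.1.2)) := by
    intro M x y
    rw [Matrix.mul_apply, Finset.sum_eq_single ((y.1.1, y.2.2), (y.2.1, y.1.2))]
    · simp [partialSwap]
    · intro z _ hz
      rw [partialSwap, of_apply, if_neg hz, mul_zero]
    · simp
  rw [hr, hl]
  simp only [transferOp, siteOp, kroneckerMap_apply, Matrix.sum_apply, map_apply]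
  rw [Finset.sum_mul_sum]
  refine Finset.sum_congr rfl fun i _ => Finset.sum_congr rfl fun j _ => ?_
  ring

/-- The purity of a reduced state as a trace over four copies of the bond space. -/
theorem sum_reducedState_mul (A : Fin d → Matrix (Fin D) (Fin D) ℂ) {n : ℕ} {X : Finset ℕ}
    (hX : X ⊆ Finset.range n) :
    ∑ a, ∑ b, reducedState A n X a b * reducedState A n X b a =
      ((transferOp A ^ n).trace⁻¹) ^ 2 *
      (List.ofFn fun j : Fin n =>
        if (j : ℕ) ∈ X then partialSwap D * (transferOp A ⊗ₖ transferOp A) * partialSwap D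
        else transferOp A ⊗ₖ transferOp A).prod.trace := by
  -- `u` on the sites in `X` and `v` on the others: if `s` and `s'` are the configurations of the
  -- two ket copies, those of the bra copies are `mix s' s` and `mix s s'`
  let mix : (Fin n → Fin d) → (Fin n → Fin d) → Fin n → Fin d := fun u v j =>
    if (j : ℕ) ∈ X then u j else v j
  let ψ := stateVector A n
  let F : (Fin n → Fin d) → (Fin n → Fin d) → ℂ := fun s s' =>
    (ψ s * star (ψ (mix s' s))) * (ψ s' * star (ψ (mix s s')))
  let G : Fin n → Fin d × Fin d →
      Matrix ((Fin D × Fin D) × (Fin D × Fin D)) ((Fin D × Fin D) × (Fin D × Fin D)) ℂ :=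
    fun j p => siteOp A p.1 (if (j : ℕ) ∈ X then p.2 else p.1) ⊗ₖ
      siteOp A p.2 (if (j : ℕ) ∈ X then p.1 else p.2)
  have hmix : ∀ (a b : X → Fin d) (c c' : {j : Fin n // (j : ℕ) ∉ X} → Fin d),
      mix (glue b c') (glue a c) = glue b c := by
    intro a b c c'
    funext j
    by_cases h : (j : ℕ) ∈ X <;> simp [mix, glue, h]
  have hG : (List.ofFn fun j : Fin n =>
      if (j : ℕ) ∈ X then partialSwap D * (transferOp A ⊗ₖ transferOp A) * partialSwap D
        else transferOp A ⊗ₖ transferOp A) = List.ofFn fun j => ∑ p, G j p := by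
    congr 1
    funext j
    rw [Fintype.sum_prod_type]
    by_cases h : (j : ℕ) ∈ X
    · simp only [h, if_true, partialSwap_conj, G]
    · simp only [h, if_false, G]
      ext x y
      simp only [transferOp, siteOp, kroneckerMap_apply, Matrix.sum_apply, map_apply]
      rw [Finset.sum_mul_sum]
  have hF : ∀ s s', F s s' = (List.ofFn fun j => G j (s j, s' j)).prod.trace := by
    intro s s'
    simp only [F, ψ]
    rw [stateVector_mul_star, stateVector_mul_star, ← trace_kronecker, prod_ofFn_kronecker]
  have h1 : ∑ a, ∑ b, reducedState A n X a b * reducedState A n X b a =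
      ((transferOp A ^ n).trace⁻¹) ^ 2 * ∑ s, ∑ s', F s s' := by
    have h2 : ∑ s, ∑ s', F s s' = ∑ a : X → Fin d, ∑ b : X → Fin d,
        ∑ c : {j : Fin n // (j : ℕ) ∉ X} → Fin d, ∑ c' : {j : Fin n // (j : ℕ) ∉ X} → Fin d,
          F (glue a c) (glue b c') := by
      rw [sum_eq_sum_glue hX]
      refine Finset.sum_congr rfl fun a _ => ?_
      simp only [sum_eq_sum_glue hX (F (glue a _))]
      exact Finset.sum_comm
    rw [h2, Finset.mul_sum]
    refine Finset.sum_congr rfl fun a _ => ?_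
    rw [Finset.mul_sum]
    refine Finset.sum_congr rfl fun b _ => ?_
    simp only [reducedState, of_apply, densityMatrix_apply, ← Finset.mul_sum, F, hmix]
    rw [← Finset.sum_mul]
    ring
  have h3 : ∑ s, ∑ s', F s s' = ∑ p : Fin n → Fin d × Fin d,
      (List.ofFn fun j => G j (p j)).prod.trace := by
    rw [← (Equiv.arrowProdEquivProdArrow (Fin n) (fun _ => Fin d) fun _ => Fin d).symm.sum_comp,
      Fintype.sum_prod_type]
    exact Finset.sum_congr rfl fun s _ => Finset.sum_congr rfl fun s' _ => hF s s'
  rw [h1, h3, hG, ← sum_prod_ofFn, trace_sum]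

/-- The last site of each group of `k` sites carries `W`, because the site with label `j` is the
spin number `j + 1`. -/
theorem prod_ofFn_everyKth {R : Type*} [Monoid R] (V W : R) {k : ℕ} (hk : 1 ≤ k) (p : ℕ) :
    (List.ofFn fun j : Fin (k * p) => if (j : ℕ) ∈ everyKth k (k * p) then W else V).prod =
      (V ^ (k - 1) * W) ^ p := by
  let g : ℕ → R := fun j => if k ∣ j + 1 then W else V
  have h0 : (List.ofFn fun j : Fin (k * p) => if (j : ℕ) ∈ everyKth k (k * p) then W else V) =
      (List.range (k * p)).map g := by
    rw [← List.map_coe_finRange_eq_range, List.map_map, List.ofFn_eq_map]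
    congr 1
    funext j
    simp [g, everyKth]
  have h1 : ∀ q r : ℕ, r < k →
      ((List.range (k * q + r)).map g).prod = ((List.range (k * q)).map g).prod * V ^ r := by
    intro q r
    induction r with
    | zero => simp
    | succ r ih =>
      intro hr
      have hnd : ¬ k ∣ k * q + r + 1 := by
        rw [add_assoc, Nat.dvd_add_right (dvd_mul_right k q)]
        exact Nat.not_dvd_of_pos_of_lt (Nat.succ_pos r) hr
      rw [← add_assoc, List.prod_range_succ, ih (by omega), mul_assoc]
      simp only [g, if_neg hnd, pow_succ]
  rw [h0]
  clear h0
  induction p with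
  | zero => simp
  | succ q ih =>
    have e : k * (q + 1) = k * q + (k - 1) + 1 := by rw [mul_add, mul_one]; omega
    have hd : k ∣ k * q + (k - 1) + 1 := e ▸ dvd_mul_right k (q + 1)
    rw [e, List.prod_range_succ, h1 q (k - 1) (by omega), ih]
    simp only [g, if_pos hd, pow_succ, mul_assoc]

theorem everyKth_subset (k n : ℕ) : everyKth k n ⊆ Finset.range n := Finset.filter_subset _ _

/-- The purity of the state of every `k`-th spin, in terms of the twisted transfer operator. -/
theorem sum_reducedState_everyKth (A : Fin d → Matrix (Fin D) (Fin D) ℂ) {k : ℕ} (hk : 1 ≤ k)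
    (p : ℕ) :
    ∑ a, ∑ b, reducedState A (k * p) (everyKth k (k * p)) a b *
        reducedState A (k * p) (everyKth k (k * p)) b a =
      ((transferOp A ^ (k * p)).trace⁻¹) ^ 2 * (twistedTransferOp A k ^ p).trace := by
  rw [sum_reducedState_mul A (everyKth_subset k _), prod_ofFn_everyKth _ _ hk, twistedTransferOp]
  simp only [mul_assoc]

/-! ### Purity and Rényi entropies -/

/-- The purity `tr ρ²` of a Hermitian matrix, as the squared Hilbert-Schmidt norm. -/
noncomputable def purity {m : Type} [Fintype m] (ρ : Matrix m m ℂ) : ℝ := ∑ a, ∑ b, ‖ρ a b‖ ^ 2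

theorem purity_nonneg {m : Type} [Fintype m] (ρ : Matrix m m ℂ) : 0 ≤ purity ρ :=
  Finset.sum_nonneg fun _ _ => Finset.sum_nonneg fun _ _ => by positivity

theorem ofReal_purity {m : Type} [Fintype m] {ρ : Matrix m m ℂ} (hρ : ρ.IsHermitian) :
    (purity ρ : ℂ) = ∑ a, ∑ b, ρ a b * ρ b a := by
  rw [purity]
  push_cast
  refine Finset.sum_congr rfl fun a _ => Finset.sum_congr rfl fun b _ => ?_
  rw [← hρ.apply b a, ← Complex.mul_conj']
  rfl

theorem sum_sq_eigenvalues {m : Type} [Fintype m] [DecidableEq m] {ρ : Matrix m m ℂ}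
    (hρ : ρ.IsHermitian) : ∑ i, hρ.eigenvalues i ^ 2 = purity ρ := by
  have h := trace_pow_eq_sum_roots ρ 2
  rw [hρ.roots_charpoly_eq_eigenvalues] at h
  have h2 : (ρ ^ 2).trace = (purity ρ : ℂ) := by
    rw [ofReal_purity hρ, pow_two, Matrix.trace]
    rfl
  rw [h2] at h
  have h3 : (purity ρ : ℂ) = ((∑ i, hρ.eigenvalues i ^ 2 : ℝ) : ℂ) := by
    rw [h]
    simp
  exact_mod_cast h3.symm

theorem renyiEntropy_two {m : Type} [Fintype m] [DecidableEq m] {ρ : Matrix m m ℂ}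
    (hρ : ρ.IsHermitian) : renyiEntropy hρ 2 = -Real.log (purity ρ) := by
  rw [renyiEntropy, if_neg (by norm_num), if_neg (by norm_num), if_neg (by norm_num),
    ← sum_sq_eigenvalues hρ]
  norm_num

theorem purity_pos {m : Type} [Fintype m] {ρ : Matrix m m ℂ} (h : ρ.trace = 1) :
    0 < purity ρ := by
  refine (purity_nonneg ρ).lt_of_ne' fun h0 => ?_
  have : ρ = 0 := by
    ext a b
    have h1 := (Finset.sum_eq_zero_iff_of_nonneg fun a _ => Finset.sum_nonneg fun b _ =>
      by positivity).1 h0 a (Finset.mem_univ a)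
    have h2 := (Finset.sum_eq_zero_iff_of_nonneg fun b _ => by positivity).1 h1 b
      (Finset.mem_univ b)
    simpa using h2
  simp [this] at h

/-- The Cauchy-Schwarz inequality for sums of products of complex numbers. -/
theorem norm_sum_mul_sq_le {ι : Type*} (s : Finset ι) (f g : ι → ℂ) :
    ‖∑ i ∈ s, f i * g i‖ ^ 2 ≤ (∑ i ∈ s, ‖f i‖ ^ 2) * ∑ i ∈ s, ‖g i‖ ^ 2 := by
  have h1 : ‖∑ i ∈ s, f i * g i‖ ≤ ∑ i ∈ s, ‖f i‖ * ‖g i‖ :=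
    (norm_sum_le _ _).trans (Finset.sum_le_sum fun i _ => (norm_mul_le _ _))
  exact (pow_le_pow_left₀ (norm_nonneg _) h1 2).trans (Finset.sum_mul_sq_le_sq_mul_sq _ _ _)

/-- The fidelity with a pure state bounds the purity from below. -/
theorem sq_norm_expectation_le_purity {m : Type} [Fintype m] (ρ : Matrix m m ℂ) {v : m → ℂ}
    (hv : ∑ a, ‖v a‖ ^ 2 = 1) : ‖star v ⬝ᵥ (ρ *ᵥ v)‖ ^ 2 ≤ purity ρ := by
  have h := norm_sum_mul_sq_le Finset.univ (fun x : m × m => star (v x.1) * v x.2)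
    fun x => ρ x.1 x.2
  have h1 : ∑ x : m × m, ‖star (v x.1) * v x.2‖ ^ 2 = 1 := by
    simp only [norm_mul, norm_star, mul_pow, Fintype.sum_prod_type, ← Finset.mul_sum, hv, mul_one]
  rw [h1, one_mul, Fintype.sum_prod_type (f := fun x : m × m => ‖ρ x.1 x.2‖ ^ 2)] at h
  refine le_trans (le_of_eq ?_) h
  congr 2
  simp only [Fintype.sum_prod_type, dotProduct, mulVec, Finset.mul_sum, Pi.star_apply]
  exact Finset.sum_congr rfl fun a _ => Finset.sum_congr rfl fun b _ => by ring

section Density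

variable {m : Type} [Fintype m] [DecidableEq m] {ρ : Matrix m m ℂ}

theorem sum_eigenvalues_of_trace_one (hρ : ρ.IsHermitian) (h1 : ρ.trace = 1) :
    ∑ i, hρ.eigenvalues i = 1 := by
  have := hρ.trace_eq_sum_eigenvalues
  rw [h1] at this
  have h3 : ((∑ i, hρ.eigenvalues i : ℝ) : ℂ) = 1 := by
    rw [this]; simp
  exact_mod_cast h3

/-- The largest eigenvalue of a density matrix is at least its purity. -/
theorem exists_purity_le_eigenvalue (hρ : ρ.PosSemidef) (h1 : ρ.trace = 1) :
    ∃ i, purity ρ ≤ hρ.1.eigenvalues i := by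
  have hsum := sum_eigenvalues_of_trace_one hρ.1 h1
  by_contra! h
  have hlt : ∑ i, hρ.1.eigenvalues i ^ 2 < ∑ i, hρ.1.eigenvalues i * purity ρ := by
    have hex : ∃ i, 0 < hρ.1.eigenvalues i := by
      by_contra! hn
      have := Finset.sum_nonpos fun i (_ : i ∈ Finset.univ) => hn i
      linarith
    obtain ⟨i, hi⟩ := hex
    refine Finset.sum_lt_sum (fun i _ => ?_) ⟨i, Finset.mem_univ i, ?_⟩
    · rw [pow_two]
      exact mul_le_mul_of_nonneg_left (h i).le (hρ.eigenvalues_nonneg i)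
    · rw [pow_two]
      exact mul_lt_mul_of_pos_left (h i) hi
  rw [sum_sq_eigenvalues, ← Finset.sum_mul, hsum, one_mul] at hlt
  exact lt_irrefl _ hlt

theorem eigenvalue_le_one (hρ : ρ.PosSemidef) (h1 : ρ.trace = 1) (i : m) :
    hρ.1.eigenvalues i ≤ 1 := by
  rw [← sum_eigenvalues_of_trace_one hρ.1 h1]
  exact Finset.single_le_sum (f := hρ.1.eigenvalues) (fun j _ => hρ.eigenvalues_nonneg j)
    (Finset.mem_univ i)

/-- A density matrix of purity close to one has small Rényi entropies of every order `α > 1`. -/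
theorem renyiEntropy_mem_Icc (hρ : ρ.PosSemidef) (h1 : ρ.trace = 1) {α : ℝ≥0∞} (hα : 1 < α) :
    0 ≤ renyiEntropy hρ.1 α ∧ renyiEntropy hρ.1 α ≤
      (if α = ⊤ then 1 else α.toReal / (α.toReal - 1)) * -Real.log (purity ρ) := by
  obtain ⟨i, hi⟩ := exists_purity_le_eigenvalue hρ h1
  have hp := purity_pos h1
  have hα0 : α ≠ 0 := (zero_lt_one.trans hα).ne'
  rw [renyiEntropy, if_neg hα0, if_neg hα.ne']
  split_ifs with htop
  · have : Nonempty m := ⟨i⟩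
    have habs : ∀ j, |hρ.1.eigenvalues j| = hρ.1.eigenvalues j := fun j =>
      abs_of_nonneg (hρ.eigenvalues_nonneg j)
    have hle : hρ.1.eigenvalues i ≤ ⨆ j, |hρ.1.eigenvalues j| := by
      have := le_ciSup (f := fun j => |hρ.1.eigenvalues j|) (Set.finite_range _).bddAbove i
      simpa only [habs] using this
    have hle1 : ⨆ j, |hρ.1.eigenvalues j| ≤ 1 := ciSup_le fun j => by
      rw [habs]; exact eigenvalue_le_one hρ h1 j
    constructor
    · exact neg_nonneg.2 (Real.log_nonpos (hp.le.trans (hi.trans hle)) hle1)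
    · rw [one_mul]
      exact neg_le_neg (Real.log_le_log hp (hi.trans hle))
  · have hα1 : 1 < α.toReal := by
      rw [← ENNReal.toReal_one]
      exact (ENNReal.toReal_lt_toReal ENNReal.one_ne_top htop).2 hα
    set a := α.toReal
    have hlow : purity ρ ^ a ≤ ∑ j, hρ.1.eigenvalues j ^ a :=
      (Real.rpow_le_rpow hp.le hi (by linarith)).trans
        (Finset.single_le_sum (f := fun j => hρ.1.eigenvalues j ^ a)
          (fun j _ => Real.rpow_nonneg (hρ.eigenvalues_nonneg j) a) (Finset.mem_univ i))
    have hup : ∑ j, hρ.1.eigenvalues j ^ a ≤ 1 := by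
      rw [← sum_eigenvalues_of_trace_one hρ.1 h1]
      refine Finset.sum_le_sum fun j _ => ?_
      have := Real.rpow_le_rpow_of_exponent_ge' (hρ.eigenvalues_nonneg j)
        (eigenvalue_le_one hρ h1 j) zero_le_one hα1.le
      rwa [Real.rpow_one] at this
    have hpa : 0 < purity ρ ^ a := Real.rpow_pos_of_pos hp a
    have hl1 : Real.log (∑ j, hρ.1.eigenvalues j ^ a) ≤ 0 :=
      Real.log_nonpos (hpa.le.trans hlow) hup
    have hl2 : a * Real.log (purity ρ) ≤ Real.log (∑ j, hρ.1.eigenvalues j ^ a) := by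
      rw [← Real.log_rpow hp]
      exact Real.log_le_log hpa hlow
    have hneg : 1 / (1 - a) ≤ 0 := one_div_nonpos.2 (by linarith)
    constructor
    · exact mul_nonneg_of_nonpos_of_nonpos hneg hl1
    · have h2 := mul_le_mul_of_nonpos_left hl2 hneg
      refine h2.trans (le_of_eq ?_)
      have e1 : 1 - a ≠ 0 := by linarith
      have e2 : a - 1 ≠ 0 := by linarith
      field_simp
      ring

end Density

theorem reducedState_posSemidef (A : Fin d → Matrix (Fin D) (Fin D) ℂ) (n : ℕ) (X : Finset ℕ) :
    (reducedState A n X).PosSemidef := by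
  have h0 : 0 ≤ (star (stateVector A n) ⬝ᵥ stateVector A n)⁻¹ :=
    inv_nonneg.2 (dotProduct_star_self_nonneg _)
  have h : reducedState A n X = (star (stateVector A n) ⬝ᵥ stateVector A n)⁻¹ •
      ∑ c : {j : Fin n // (j : ℕ) ∉ X} → Fin d,
        vecMulVec (fun a => stateVector A n (glue a c))
          (star fun a => stateVector A n (glue a c)) := by
    ext a b
    simp [reducedState, densityMatrix, vecMulVec_apply, Matrix.sum_apply, Finset.mul_sum]
  rw [h]
  exact (posSemidef_sum _ fun c _ => posSemidef_vecMulVec_self_star _).smul h0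

/-! ### The entropy density -/

theorem IsGapped.nonempty {m : Type} [Fintype m] [DecidableEq m] {T : Matrix m m ℂ}
    (hT : IsGapped T 1) : Nonempty m := by
  obtain ⟨-, s, hs, -⟩ := hT
  by_contra hm
  rw [not_nonempty_iff] at hm
  simp [Matrix.charpoly] at hs

theorem purity_everyKth (A : Fin d → Matrix (Fin D) (Fin D) ℂ) {k : ℕ} (hk : 1 ≤ k) (p : ℕ)
    (h0 : (transferOp A ^ (k * p)).trace ≠ 0) :
    purity (reducedState A (k * p) (everyKth k (k * p))) * ‖(transferOp A ^ (k * p)).trace‖ ^ 2 =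
      ‖(twistedTransferOp A k ^ p).trace‖ := by
  have h := sum_reducedState_everyKth A hk p
  rw [← ofReal_purity (reducedState_isHermitian A _ _)] at h
  have h1 := congrArg norm h
  rw [Complex.norm_real, Real.norm_of_nonneg (purity_nonneg _), norm_mul, norm_pow, norm_inv] at h1
  have h2 : ‖(transferOp A ^ (k * p)).trace‖ ≠ 0 := norm_ne_zero_iff.2 h0
  rw [h1]
  field_simp

theorem tendsto_mul_const_atTop {k : ℕ} (hk : 1 ≤ k) : Tendsto (fun p : ℕ => k * p) atTop atTop :=
  tendsto_id.const_mul_atTop' hk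

theorem IsGapped.eventually_trace_ne_zero {m : Type} [Fintype m] [DecidableEq m]
    {T : Matrix m m ℂ} (hT : IsGapped T 1) : ∀ᶠ n : ℕ in atTop, (T ^ n).trace ≠ 0 :=
  hT.tendsto_trace_pow.eventually_ne one_ne_zero

/-- The entropy density is minus the logarithm of the spectral radius of the twisted transfer
operator, and the latter is not nilpotent because the purity of a density matrix is positive. -/
theorem entropyDensity_eq {A : Fin d → Matrix (Fin D) (Fin D) ℂ}
    (hgap : IsGapped (transferOp A) 1) {k : ℕ} (hk : 1 ≤ k) {t : ℂ}
    (ht : IsTopEigenvalue (twistedTransferOp A k) t) :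
    t ≠ 0 ∧ entropyDensity A k = ((-Real.log ‖t‖ : ℝ) : EReal) := by
  have hkp := tendsto_mul_const_atTop hk
  have hne := hkp.eventually hgap.eventually_trace_ne_zero
  have hq : ∀ᶠ p : ℕ in atTop, 0 < purity (reducedState A (k * p) (everyKth k (k * p))) ∧
      purity (reducedState A (k * p) (everyKth k (k * p))) *
        ‖(transferOp A ^ (k * p)).trace‖ ^ 2 = ‖(twistedTransferOp A k ^ p).trace‖ := by
    filter_upwards [hne] with p hp
    exact ⟨purity_pos (trace_reducedState A (everyKth_subset k _) hp), purity_everyKth A hk p hp⟩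
  have ht0 : t ≠ 0 := by
    rintro rfl
    obtain ⟨p, ⟨h1, h2⟩, hp0, hp⟩ := (hq.and ((eventually_gt_atTop 0).and hne)).exists
    have h3 := norm_trace_pow_le ht p
    rw [norm_zero, zero_pow hp0.ne', mul_zero, ← h2] at h3
    have : 0 < ‖(transferOp A ^ (k * p)).trace‖ := norm_pos_iff.2 hp
    have : 0 < purity (reducedState A (k * p) (everyKth k (k * p))) *
        ‖(transferOp A ^ (k * p)).trace‖ ^ 2 := by positivity
    linarith
  refine ⟨ht0, ?_⟩
  have hc : Tendsto (fun p : ℕ => ‖(transferOp A ^ (k * p)).trace‖ ^ 2) atTop (𝓝 1) := by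
    simpa using ((hgap.tendsto_trace_pow.comp hkp).norm.pow 2)
  rw [← liminf_neg_log_div_eq ht ht0 hc hq, entropyDensity]
  congr 1
  funext p
  rw [entropyEveryKth, renyiEntropy_two]
  congr 1
  have hk0 : (k : ℝ) ≠ 0 := by positivity
  push_cast
  rcases eq_or_ne p 0 with rfl | hp
  · simp
  · field_simp

/-! ### Bond-space operators as vectors -/

/-- A bond-space operator, regarded as a vector on two copies of the bond space. -/
def vecB (X : Matrix (Fin D) (Fin D) ℂ) : Fin D × Fin D → ℂ := fun x => X x.1 x.2

/-- The linear functional `X ↦ tr (Λ X)`, as a covector on two copies of the bond space. -/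
def covec (Λ : Matrix (Fin D) (Fin D) ℂ) : Fin D × Fin D → ℂ := fun x => Λ x.2 x.1

theorem vecB_injective : Function.Injective (vecB (D := D)) := fun X Y h => by
  ext a b
  exact congrFun h (a, b)

theorem vecB_ne_zero {X : Matrix (Fin D) (Fin D) ℂ} (hX : X ≠ 0) : vecB X ≠ 0 :=
  fun h => hX (vecB_injective h)

theorem covec_dotProduct_vecB (Λ X : Matrix (Fin D) (Fin D) ℂ) :
    covec Λ ⬝ᵥ vecB X = (Λ * X).trace := by
  rw [trace_mul_comm, dotProduct, Fintype.sum_prod_type, Matrix.trace]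
  refine Finset.sum_congr rfl fun a _ => ?_
  rw [diag_apply, Matrix.mul_apply]
  exact Finset.sum_congr rfl fun b _ => mul_comm _ _

theorem kronecker_mulVec_vecB (M N X : Matrix (Fin D) (Fin D) ℂ) :
    (M ⊗ₖ N.map star) *ᵥ vecB X = vecB (M * X * Nᴴ) := by
  funext x
  simp only [vecB, mulVec, dotProduct, Fintype.sum_prod_type, kroneckerMap_apply, map_apply,
    Matrix.mul_apply, conjTranspose_apply, Finset.sum_mul]
  rw [Finset.sum_comm]
  exact Finset.sum_congr rfl fun a _ => Finset.sum_congr rfl fun b _ => by ring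

theorem covec_vecMul_kronecker (M N Λ : Matrix (Fin D) (Fin D) ℂ) :
    covec Λ ᵥ* (M ⊗ₖ N.map star) = covec (Nᴴ * Λ * M) := by
  funext x
  simp only [covec, vecMul, dotProduct, Fintype.sum_prod_type, kroneckerMap_apply, map_apply,
    Matrix.mul_apply, conjTranspose_apply, Finset.sum_mul]
  exact Finset.sum_congr rfl fun a _ => Finset.sum_congr rfl fun b _ => by ring

theorem siteOp_mulVec_vecB (A : Fin d → Matrix (Fin D) (Fin D) ℂ) (i j : Fin d)
    (X : Matrix (Fin D) (Fin D) ℂ) : siteOp A i j *ᵥ vecB X = vecB (A i * X * (A j)ᴴ) :=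
  kronecker_mulVec_vecB _ _ _

theorem vecB_sum {ι : Type*} (s : Finset ι) (f : ι → Matrix (Fin D) (Fin D) ℂ) :
    vecB (∑ i ∈ s, f i) = ∑ i ∈ s, vecB (f i) := by
  funext x
  simp [vecB, Matrix.sum_apply]

theorem covec_sum {ι : Type*} (s : Finset ι) (f : ι → Matrix (Fin D) (Fin D) ℂ) :
    covec (∑ i ∈ s, f i) = ∑ i ∈ s, covec (f i) := by
  funext x
  simp [covec, Matrix.sum_apply]

theorem transferOp_mulVec_vecB (A : Fin d → Matrix (Fin D) (Fin D) ℂ)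
    (X : Matrix (Fin D) (Fin D) ℂ) : transferOp A *ᵥ vecB X = vecB (cpMap A X) := by
  rw [transferOp, cpMap, sum_mulVec, vecB_sum]
  exact Finset.sum_congr rfl fun i _ => kronecker_mulVec_vecB _ _ _

theorem covec_vecMul_transferOp (A : Fin d → Matrix (Fin D) (Fin D) ℂ)
    (Λ : Matrix (Fin D) (Fin D) ℂ) : covec Λ ᵥ* transferOp A = covec (cpMapAdjoint A Λ) := by
  rw [transferOp, cpMapAdjoint, vecMul_sum, covec_sum]
  exact Finset.sum_congr rfl fun i _ => covec_vecMul_kronecker _ _ _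

theorem transferOp_pow (A : Fin d → Matrix (Fin D) (Fin D) ℂ) (n : ℕ) :
    transferOp A ^ n = ∑ s : Fin n → Fin d, (List.ofFn fun j => A (s j)).prod ⊗ₖ
      (List.ofFn fun j => A (s j)).prod.map star := by
  have h : transferOp A ^ n = (List.ofFn fun _ : Fin n => ∑ i, siteOp A i i).prod := by
    simp [List.ofFn_const, transferOp, siteOp]
  rw [h, ← sum_prod_ofFn n fun _ i => siteOp A i i]
  refine Finset.sum_congr rfl fun s _ => ?_
  rw [prod_ofFn_map_star, prod_ofFn_kronecker]
  rfl

theorem eq_zero_of_rank_eq_zero {m : Type} [Fintype m] [DecidableEq m] {X : Matrix m m ℂ}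
    (h : X.rank = 0) : X = 0 := by
  have := Submodule.finrank_eq_zero.1 (h : Module.finrank ℂ X.mulVecLin.range = 0)
  rw [LinearMap.range_eq_bot, ← Matrix.toLin'_apply'] at this
  exact (LinearEquiv.map_eq_zero_iff _).1 this

theorem rank_eq_one_iff_exists_vecMulVec {m : Type} [Fintype m] [DecidableEq m] (X : Matrix m m ℂ) :
    X.rank = 1 ↔ X ≠ 0 ∧ ∃ u w : m → ℂ, X = vecMulVec u w := by
  constructor
  · intro h
    refine ⟨fun h0 => by simp [h0] at h, ?_⟩
    obtain ⟨⟨u, hu⟩, -, hspan⟩ := finrank_eq_one_iff'.1 (h : Module.finrank ℂ X.mulVecLin.range = 1)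
    have hcol : ∀ j, ∃ c : ℂ, c • u = X *ᵥ Pi.single j 1 := fun j => by
      obtain ⟨c, hc⟩ := hspan ⟨X *ᵥ Pi.single j 1, ⟨Pi.single j 1, rfl⟩⟩
      exact ⟨c, congrArg Subtype.val hc⟩
    choose w hw using hcol
    refine ⟨u, w, ?_⟩
    ext i j
    have := congrFun (hw j) i
    simp only [mulVec_single_one, Pi.smul_apply, smul_eq_mul, col_apply] at this
    rw [vecMulVec_apply, ← this, mul_comm]
  · rintro ⟨h0, u, w, rfl⟩
    refine le_antisymm (rank_vecMulVec_le u w) (Nat.one_le_iff_ne_zero.2 fun hr => h0 ?_)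
    exact eq_zero_of_rank_eq_zero hr

/-- The leading eigenvector is a product vector exactly when the leading eigenoperator has rank
one. -/
theorem exists_productVector_iff (A : Fin d → Matrix (Fin D) (Fin D) ℂ) :
    (∃ v : Fin D × Fin D → ℂ, v ≠ 0 ∧ (transferOp A).mulVec v = v ∧ IsProductVector v) ↔
      ∃ X : Matrix (Fin D) (Fin D) ℂ, cpMap A X = X ∧ X.rank = 1 := by
  constructor
  · rintro ⟨v, hv0, hv, φ, χ, rfl⟩
    have e : (fun x : Fin D × Fin D => φ x.1 * χ x.2) = vecB (vecMulVec φ χ) := rfl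
    rw [e] at hv hv0
    refine ⟨vecMulVec φ χ, vecB_injective ?_,
      (rank_eq_one_iff_exists_vecMulVec _).2 ⟨?_, φ, χ, rfl⟩⟩
    · rw [← transferOp_mulVec_vecB, hv]
    · intro h0
      exact hv0 (by rw [h0]; rfl)
  · rintro ⟨X, hX, hr⟩
    obtain ⟨h0, u, w, rfl⟩ := (rank_eq_one_iff_exists_vecMulVec _).1 hr
    exact ⟨vecB (vecMulVec u w), vecB_ne_zero h0, by rw [transferOp_mulVec_vecB, hX], u, w, rfl⟩

/-! ### The leading block of a canonical form -/

/-- `P` is the projector on the block with weight one of a tensor in canonical form and `Λ` is the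
fixed point of the adjoint map on this block, normalized to trace one. -/
structure IsLeadingBlock (A : Fin d → Matrix (Fin D) (Fin D) ℂ)
    (P Λ : Matrix (Fin D) (Fin D) ℂ) : Prop where
  isHermitian : P.IsHermitian
  mul_self : P * P = P
  ne_zero : P ≠ 0
  comm : ∀ i, P * A i = A i * P
  cpMap_eq : cpMap A P = P
  posSemidef : Λ.PosSemidef
  mul_mul : P * Λ * P = Λ
  rank_eq : Λ.rank = P.rank
  cpMapAdjoint_eq : cpMapAdjoint A Λ = Λ
  trace_eq : Λ.trace = 1

theorem cpMap_smul (A : Fin d → Matrix (Fin D) (Fin D) ℂ) (c : ℂ) (X : Matrix (Fin D) (Fin D) ℂ) :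
    cpMap A (c • X) = c • cpMap A X := by
  simp [cpMap, Finset.smul_sum]

theorem cpMap_sum (A : Fin d → Matrix (Fin D) (Fin D) ℂ) {ι : Type*} (s : Finset ι)
    (f : ι → Matrix (Fin D) (Fin D) ℂ) : cpMap A (∑ i ∈ s, f i) = ∑ i ∈ s, cpMap A (f i) := by
  simp only [cpMap, Finset.mul_sum, Finset.sum_mul]
  exact Finset.sum_comm

theorem transferOp_pow_mulVec_vecB (A : Fin d → Matrix (Fin D) (Fin D) ℂ)
    (X : Matrix (Fin D) (Fin D) ℂ) (n : ℕ) :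
    transferOp A ^ n *ᵥ vecB X = vecB ((cpMap A)^[n] X) := by
  induction n with
  | zero => simp
  | succ n ih =>
    rw [pow_succ', ← mulVec_mulVec, ih, transferOp_mulVec_vecB, Function.iterate_succ_apply']

/-- If the powers of the completely positive map, applied to the identity, tend to zero, then so
does the norm of the state vector. Indeed `|tr W|² ≤ D tr (W W†)` for every word `W` of length `n`;
summed over the words, the two sides are `tr (T ^ n)` and `D` times the trace of the `n`-th
iterate. -/
theorem tendsto_trace_transferOp_pow_zero {A : Fin d → Matrix (Fin D) (Fin D) ℂ}
    (h : Tendsto (fun n : ℕ => (cpMap A)^[n] 1) atTop (𝓝 0)) :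
    Tendsto (fun n : ℕ => (transferOp A ^ n).trace) atTop (𝓝 0) := by
  have hle : ∀ n : ℕ, ‖(transferOp A ^ n).trace‖ ≤ D * ‖((cpMap A)^[n] 1).trace‖ := by
    intro n
    have h1 : (transferOp A ^ n).trace = ((∑ s : Fin n → Fin d,
        ‖(List.ofFn fun j => A (s j)).prod.trace‖ ^ 2 : ℝ) : ℂ) := by
      rw [transferOp_pow, trace_sum]
      push_cast
      refine Finset.sum_congr rfl fun s _ => ?_
      rw [trace_kronecker, trace_map_star, ← Complex.mul_conj']
      rfl
    have h2 : ((cpMap A)^[n] 1).trace = ((∑ s : Fin n → Fin d, ∑ a, ∑ b,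
        ‖(List.ofFn fun j => A (s j)).prod a b‖ ^ 2 : ℝ) : ℂ) := by
      have h3 : (cpMap A)^[n] 1 = ∑ s : Fin n → Fin d, (List.ofFn fun j => A (s j)).prod *
          ((List.ofFn fun j => A (s j)).prod)ᴴ := by
        apply vecB_injective
        rw [← transferOp_pow_mulVec_vecB, transferOp_pow, sum_mulVec, vecB_sum]
        refine Finset.sum_congr rfl fun s _ => ?_
        rw [kronecker_mulVec_vecB, mul_one]
      rw [h3, trace_sum]
      push_cast
      refine Finset.sum_congr rfl fun s _ => ?_
      rw [Matrix.trace]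
      refine Finset.sum_congr rfl fun a _ => ?_
      rw [diag_apply, Matrix.mul_apply]
      refine Finset.sum_congr rfl fun b _ => ?_
      rw [conjTranspose_apply, ← Complex.mul_conj']
      rfl
    rw [h1, h2, Complex.norm_real, Complex.norm_real, Real.norm_of_nonneg (by positivity),
      Real.norm_of_nonneg (by positivity), Finset.mul_sum]
    refine Finset.sum_le_sum fun s _ => ?_
    set W := (List.ofFn fun j => A (s j)).prod
    have h4 := norm_sum_mul_sq_le Finset.univ (fun _ : Fin D => (1 : ℂ)) fun a => W a a
    simp only [one_mul, norm_one, one_pow, Finset.sum_const, Finset.card_univ, Fintype.card_fin,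
      nsmul_eq_mul, mul_one] at h4
    refine h4.trans (mul_le_mul_of_nonneg_left ?_ (Nat.cast_nonneg D))
    exact Finset.sum_le_sum fun a _ => Finset.single_le_sum (f := fun b => ‖W a b‖ ^ 2)
      (fun b _ => by positivity) (Finset.mem_univ a)
  have htr : Tendsto (fun n : ℕ => (D : ℝ) * ‖((cpMap A)^[n] 1).trace‖) atTop (𝓝 0) := by
    have hc : Continuous fun M : Matrix (Fin D) (Fin D) ℂ => (D : ℝ) * ‖M.trace‖ := by fun_prop
    simpa [Function.comp_def] using (hc.tendsto 0).comp h
  exact squeeze_zero_norm hle htr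

/-- The gap condition forces some block of a canonical form to have weight one: weights above
one are excluded because `λⱼ²` is an eigenvalue, and if all weights were below one then the state
vectors would tend to zero. -/
theorem IsCanonicalForm.exists_isLeadingBlock {A : Fin d → Matrix (Fin D) (Fin D) ℂ}
    (hA : IsCanonicalForm A) (hgap : IsGapped (transferOp A) 1) : ∃ P Λ, IsLeadingBlock A P Λ := by
  obtain ⟨m, P, lam, B, Λ, hP, horth, hsum, hlam, hB, hAB, hfix, hΛ⟩ := hA
  have hPB : ∀ j i, P j * B j i = B j i := fun j i => by
    rw [← hB j i, ← mul_assoc, ← mul_assoc, (hP j).2.2]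
  have hBP : ∀ j i, B j i * P j = B j i := fun j i => by
    rw [← hB j i, mul_assoc, (hP j).2.2]
  have hPA : ∀ j i, P j * A i = (lam j : ℂ) • B j i := fun j i => by
    rw [hAB, Finset.mul_sum, Finset.sum_eq_single j]
    · rw [mul_smul_comm, hPB]
    · intro l _ hl
      rw [mul_smul_comm, ← hPB l i, ← mul_assoc, horth j l hl.symm, zero_mul, smul_zero]
    · simp
  have hAP : ∀ j i, A i * P j = (lam j : ℂ) • B j i := fun j i => by
    rw [hAB, Finset.sum_mul, Finset.sum_eq_single j]
    · rw [smul_mul_assoc, hBP]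
    · intro l _ hl
      rw [smul_mul_assoc, ← hBP l i, mul_assoc, horth l j hl, mul_zero, smul_zero]
    · simp
  have hcp : ∀ j, cpMap A (P j) = ((lam j : ℂ) ^ 2) • P j := fun j => by
    have hBfix : cpMap (B j) (P j) = P j := (hfix j (P j)).2 ⟨1, (one_smul _ _).symm⟩
    have : ∀ i, A i * P j * (A i)ᴴ = ((lam j : ℂ) ^ 2) • (B j i * P j * (B j i)ᴴ) := fun i => by
      have h1 : P j * (A i)ᴴ = (lam j : ℂ) • (B j i)ᴴ := by
        have := congrArg conjTranspose (hAP j i)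
        rw [conjTranspose_mul, (hP j).2.1.eq, conjTranspose_smul] at this
        simpa using this
      have h2 : A i * P j * (A i)ᴴ = (A i * P j) * (P j * (A i)ᴴ) := by
        rw [← mul_assoc, mul_assoc (A i) (P j) (P j), (hP j).2.2]
      rw [h2, hAP, h1, hBP, smul_mul_smul_comm, pow_two]
    rw [cpMap, Finset.sum_congr rfl fun i _ => this i, ← Finset.smul_sum]
    exact congrArg _ hBfix
  have hlam1 : ∀ j, lam j = 1 ∨ lam j < 1 := fun j => by
    have hv : transferOp A *ᵥ vecB (P j) = ((lam j : ℂ) ^ 2) • vecB (P j) := by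
      rw [transferOp_mulVec_vecB, hcp]; rfl
    have hle : lam j ^ 2 ≤ 1 := by
      rcases hgap.norm_le_one (vecB_ne_zero (hP j).1) hv with h | h
      · exact_mod_cast (congrArg Complex.re h).le.trans' (by norm_cast)
      · rw [norm_pow, Complex.norm_real, Real.norm_of_nonneg (hlam j)] at h
        exact h.le
    have : lam j ≤ 1 := by nlinarith [hlam j]
    exact this.eq_or_lt
  obtain ⟨j, hj⟩ : ∃ j, lam j = 1 := by
    by_contra! hne
    have hlt : ∀ j, lam j < 1 := fun j => (hlam1 j).resolve_left (hne j)
    have hit : ∀ n : ℕ, (cpMap A)^[n] 1 = ∑ j, (((lam j : ℂ) ^ 2) ^ n) • P j := fun n => by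
      induction n with
      | zero => simp [hsum]
      | succ n ih =>
        rw [Function.iterate_succ_apply', ih, cpMap_sum]
        refine Finset.sum_congr rfl fun j _ => ?_
        rw [cpMap_smul, hcp, smul_smul, ← pow_succ]
    have hlim : Tendsto (fun n : ℕ => (cpMap A)^[n] 1) atTop (𝓝 0) := by
      have : Tendsto (fun n : ℕ => ∑ j, (((lam j : ℂ) ^ 2) ^ n) • P j) atTop
          (𝓝 (∑ j, (0 : ℂ) • P j)) := by
        refine tendsto_finsetSum _ fun j _ => Tendsto.smul_const ?_ _
        refine tendsto_pow_atTop_nhds_zero_of_norm_lt_one ?_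
        rw [norm_pow, Complex.norm_real, Real.norm_of_nonneg (hlam j)]
        exact pow_lt_one₀ (hlam j) (hlt j) two_ne_zero
      simp only [zero_smul, Finset.sum_const_zero] at this
      exact this.congr fun n => (hit n).symm
    exact zero_ne_one (tendsto_nhds_unique (tendsto_trace_transferOp_pow_zero hlim)
      hgap.tendsto_trace_pow)
  obtain ⟨hΛ1, hΛ2, hΛ3, hΛ4⟩ := hΛ j
  have htr : (Λ j).trace ≠ 0 := fun h => by
    rw [hΛ1.trace_eq_zero_iff] at h
    rw [h, rank_zero] at hΛ3
    exact (hP j).1 (eq_zero_of_rank_eq_zero hΛ3.symm)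
  have hfixA : cpMapAdjoint A (Λ j) = Λ j := by
    have h1 : ∀ i, (A i)ᴴ * Λ j * A i = (B j i)ᴴ * Λ j * B j i := fun i => by
      have e1 : P j * A i = B j i := by rw [hPA, hj]; simp
      have e2 : (A i)ᴴ * P j = (B j i)ᴴ := by
        rw [← e1, conjTranspose_mul, (hP j).2.1.eq]
      calc (A i)ᴴ * Λ j * A i = (A i)ᴴ * (P j * Λ j * P j) * A i := by rw [hΛ2]
        _ = ((A i)ᴴ * P j) * Λ j * (P j * A i) := by simp only [mul_assoc]
        _ = _ := by rw [e1, e2]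
    rw [cpMapAdjoint, Finset.sum_congr rfl fun i _ => h1 i]
    exact hΛ4
  refine ⟨P j, (Λ j).trace⁻¹ • Λ j, (hP j).2.1, (hP j).2.2, (hP j).1, fun i => by rw [hPA, hAP],
    by rw [hcp, hj]; simp, hΛ1.smul (inv_nonneg.2 hΛ1.trace_nonneg), ?_, ?_, ?_, ?_⟩
  · rw [mul_smul_comm, smul_mul_assoc, hΛ2]
  · rw [rank_smul_of_mem_nonZeroDivisors _ (mem_nonZeroDivisors_of_ne_zero (inv_ne_zero htr)), hΛ3]
  · have : cpMapAdjoint A ((Λ j).trace⁻¹ • Λ j) = (Λ j).trace⁻¹ • cpMapAdjoint A (Λ j) := by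
      simp [cpMapAdjoint, Finset.smul_sum]
    rw [this, hfixA]
  · rw [trace_smul, smul_eq_mul, inv_mul_cancel₀ htr]

/-! ### The thermodynamic limit of reduced states -/

theorem IsLeadingBlock.mul_projector {A : Fin d → Matrix (Fin D) (Fin D) ℂ}
    {P Λ : Matrix (Fin D) (Fin D) ℂ} (h : IsLeadingBlock A P Λ) : Λ * P = Λ := by
  rw [← h.mul_mul, mul_assoc, h.mul_self]

theorem IsLeadingBlock.covec_dotProduct {A : Fin d → Matrix (Fin D) (Fin D) ℂ}
    {P Λ : Matrix (Fin D) (Fin D) ℂ} (h : IsLeadingBlock A P Λ) : covec Λ ⬝ᵥ vecB P = 1 := by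
  rw [covec_dotProduct_vecB, h.mul_projector, h.trace_eq]

theorem IsLeadingBlock.transferOp_mulVec {A : Fin d → Matrix (Fin D) (Fin D) ℂ}
    {P Λ : Matrix (Fin D) (Fin D) ℂ} (h : IsLeadingBlock A P Λ) :
    transferOp A *ᵥ vecB P = vecB P := by
  rw [transferOp_mulVec_vecB, h.cpMap_eq]

theorem IsLeadingBlock.vecMul_transferOp {A : Fin d → Matrix (Fin D) (Fin D) ℂ}
    {P Λ : Matrix (Fin D) (Fin D) ℂ} (h : IsLeadingBlock A P Λ) :
    covec Λ ᵥ* transferOp A = covec Λ := by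
  rw [covec_vecMul_transferOp, h.cpMapAdjoint_eq]

theorem IsLeadingBlock.tendsto_pow {A : Fin d → Matrix (Fin D) (Fin D) ℂ}
    {P Λ : Matrix (Fin D) (Fin D) ℂ} (h : IsLeadingBlock A P Λ)
    (hgap : IsGapped (transferOp A) 1) :
    Tendsto (fun n : ℕ => transferOp A ^ n) atTop (𝓝 (vecMulVec (vecB P) (covec Λ))) :=
  hgap.tendsto_pow h.transferOp_mulVec h.vecMul_transferOp h.covec_dotProduct

theorem prod_ofFn_eq_mul_pow {R : Type*} [Monoid R] (g : ℕ → R) (V : R) {N : ℕ}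
    (hg : ∀ j, N ≤ j → g j = V) (m : ℕ) :
    (List.ofFn fun j : Fin (N + m) => g j).prod =
      (List.ofFn fun j : Fin N => g j).prod * V ^ m := by
  induction m with
  | zero => simp
  | succ m ih =>
    have : (List.ofFn fun j : Fin (N + (m + 1)) => g j) =
        (List.ofFn fun j : Fin (N + m) => g j).concat (g (N + m)) :=
      List.ofFn_succ' (n := N + m) fun j => g j
    rw [this, List.concat_eq_append, List.prod_append, List.prod_singleton, ih,
      hg _ (Nat.le_add_right N m), mul_assoc, ← pow_succ]

theorem trace_mul_vecMulVec {m : Type} [Fintype m] (M : Matrix m m ℂ) (r l : m → ℂ) :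
    (M * vecMulVec r l).trace = l ⬝ᵥ (M *ᵥ r) := by
  rw [mul_vecMulVec, trace_vecMulVec, dotProduct_comm]

/-- Far from `X` the chain acts as the leading projector, so only the sites up to the last one in
`X` enter the limit. -/
theorem IsLeadingBlock.tendsto_reducedState {A : Fin d → Matrix (Fin D) (Fin D) ℂ}
    {P Λ : Matrix (Fin D) (Fin D) ℂ} (h : IsLeadingBlock A P Λ)
    (hgap : IsGapped (transferOp A) 1) {X : Finset ℕ} {N : ℕ} (hX : X ⊆ Finset.range N)
    (a b : X → Fin d) :
    Tendsto (fun n : ℕ => reducedState A n X a b) atTop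
      (𝓝 (covec Λ ⬝ᵥ ((List.ofFn fun j : Fin N => if h : (j : ℕ) ∈ X then
        siteOp A (a ⟨j, h⟩) (b ⟨j, h⟩) else transferOp A).prod *ᵥ vecB P))) := by
  let g : ℕ → Matrix (Fin D × Fin D) (Fin D × Fin D) ℂ := fun j =>
    if h : j ∈ X then siteOp A (a ⟨j, h⟩) (b ⟨j, h⟩) else transferOp A
  have hg : ∀ j, N ≤ j → g j = transferOp A := fun j hj =>
    dif_neg fun hjX => (Finset.mem_range.1 (hX hjX)).not_ge hj
  rw [← tendsto_add_atTop_iff_nat N]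
  set E := (List.ofFn fun j : Fin N => g j).prod with hE
  have h1 : ∀ m : ℕ, reducedState A (m + N) X a b =
      (transferOp A ^ (m + N)).trace⁻¹ * (E * transferOp A ^ m).trace := fun m => by
    rw [add_comm m N, reducedState_apply, hE, ← prod_ofFn_eq_mul_pow g _ hg]
  have h2 : Tendsto (fun m : ℕ => (transferOp A ^ (m + N)).trace⁻¹) atTop (𝓝 1) := by
    simpa using ((tendsto_add_atTop_iff_nat N).2 hgap.tendsto_trace_pow).inv₀ one_ne_zero
  have h3 : Tendsto (fun m : ℕ => (E * transferOp A ^ m).trace) atTop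
      (𝓝 (covec Λ ⬝ᵥ (E *ᵥ vecB P))) := by
    have hc : Continuous fun M : Matrix (Fin D × Fin D) (Fin D × Fin D) ℂ => (E * M).trace := by
      fun_prop
    rw [← trace_mul_vecMulVec]
    exact (hc.tendsto _).comp (h.tendsto_pow hgap)
  have h4 := h2.mul h3
  rw [one_mul] at h4
  exact h4.congr fun m => (h1 m).symm

theorem prod_ofFn_mulVec {m : Type} [Fintype m] [DecidableEq m] {n : ℕ} (E : Fin n → Matrix m m ℂ)
    (c : Fin n → ℂ) (r : m → ℂ) (h : ∀ j, E j *ᵥ r = c j • r) :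
    (List.ofFn E).prod *ᵥ r = (∏ j, c j) • r := by
  induction n with
  | zero => simp
  | succ n ih =>
    rw [List.ofFn_succ, List.prod_cons, ← mulVec_mulVec, ih _ _ fun j => h j.succ, mulVec_smul, h,
      smul_smul, Fin.prod_univ_succ, mul_comm]

theorem prod_fin_dite {X : Finset ℕ} {N : ℕ} (hX : X ⊆ Finset.range N) (f : X → ℂ) :
    ∏ j : Fin N, (if h : (j : ℕ) ∈ X then f ⟨j, h⟩ else 1) = ∏ x : X, f x := by
  let g : ℕ → ℂ := fun j => if h : j ∈ X then f ⟨j, h⟩ else 1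
  have h1 : ∏ j : Fin N, g j = ∏ x : X, g x := by
    rw [Fin.prod_univ_eq_prod_range g N, Finset.prod_coe_sort]
    exact (Finset.prod_subset hX fun j _ hj => dif_neg hj).symm
  refine h1.trans (Finset.prod_congr rfl fun x _ => ?_)
  simp [g]

/-! ### A leading block of dimension one -/

/-- On a one-dimensional leading block the tensor acts by scalars, which are the amplitudes of a
unit vector in the physical space. -/
theorem IsLeadingBlock.exists_amplitudes {A : Fin d → Matrix (Fin D) (Fin D) ℂ}
    {P Λ : Matrix (Fin D) (Fin D) ℂ} (h : IsLeadingBlock A P Λ) (hr : P.rank = 1) :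
    ∃ φ : Fin d → ℂ, ∑ i, ‖φ i‖ ^ 2 = 1 ∧ (∀ i, A i * P = φ i • P) ∧ P.trace = 1 := by
  obtain ⟨h0, u, w, huw⟩ := (rank_eq_one_iff_exists_vecMulVec P).1 hr
  -- compressions to a one-dimensional range are scalars
  have hsand : ∀ M, P * M * P = (w ⬝ᵥ (M *ᵥ u)) • P := fun M => by
    rw [huw, vecMulVec_mul, vecMulVec_mul_vecMulVec, dotProduct_mulVec]
    ext i j
    simp [vecMulVec_apply]
    ring
  have htr : P.trace = 1 := by
    have h1 := hsand 1
    rw [mul_one, h.mul_self, one_mulVec] at h1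
    have h2 : w ⬝ᵥ u = 1 := by
      by_contra hne
      apply h0
      have : (1 - w ⬝ᵥ u) • P = 0 := by rw [sub_smul, one_smul, ← h1, sub_self]
      exact (smul_eq_zero.1 this).resolve_left (sub_ne_zero.2 (Ne.symm hne))
    rw [huw, trace_vecMulVec, dotProduct_comm, h2]
  have hA : ∀ i, A i * P = (w ⬝ᵥ (A i *ᵥ u)) • P := fun i => by
    rw [← hsand, h.comm, mul_assoc, h.mul_self]
  refine ⟨fun i => w ⬝ᵥ (A i *ᵥ u), ?_, hA, htr⟩
  set φ : Fin d → ℂ := fun i => w ⬝ᵥ (A i *ᵥ u)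
  have hterm : ∀ i, A i * P * (A i)ᴴ = ((‖φ i‖ ^ 2 : ℝ) : ℂ) • P := fun i => by
    have h1 : P * (A i)ᴴ = star (φ i) • P := by
      have := congrArg conjTranspose (hA i)
      rwa [conjTranspose_mul, h.isHermitian.eq, conjTranspose_smul, h.isHermitian.eq] at this
    rw [hA, smul_mul_assoc, h1, smul_smul]
    congr 1
    push_cast
    exact Complex.mul_conj' _
  have h1 := congrArg trace h.cpMap_eq
  rw [cpMap, Finset.sum_congr rfl fun i _ => hterm i, ← Finset.sum_smul, trace_smul, htr,
    smul_eq_mul, mul_one] at h1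
  exact_mod_cast h1

/-- A one-dimensional block is a common eigenvector of all inserted operators. -/
theorem siteOp_mulVec_of_amplitudes {A : Fin d → Matrix (Fin D) (Fin D) ℂ}
    {P : Matrix (Fin D) (Fin D) ℂ} (hP : P.IsHermitian) {φ : Fin d → ℂ}
    (hA : ∀ i, A i * P = φ i • P) (i j : Fin d) :
    siteOp A i j *ᵥ vecB P = (φ i * star (φ j)) • vecB P := by
  have h1 : P * (A j)ᴴ = star (φ j) • P := by
    have := congrArg conjTranspose (hA j)
    rwa [conjTranspose_mul, hP.eq, conjTranspose_smul, hP.eq] at this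
  rw [siteOp_mulVec_vecB, hA, smul_mul_assoc, h1, smul_smul]
  rfl

theorem IsLeadingBlock.tendsto_productState {A : Fin d → Matrix (Fin D) (Fin D) ℂ}
    {P Λ : Matrix (Fin D) (Fin D) ℂ} (h : IsLeadingBlock A P Λ)
    (hgap : IsGapped (transferOp A) 1) {φ : Fin d → ℂ} (hA : ∀ i, A i * P = φ i • P)
    (X : Finset ℕ) :
    Tendsto (fun n : ℕ => reducedState A n X) atTop
      (𝓝 (productState X fun _ => vecMulVec φ (star φ))) := by
  refine tendsto_pi_nhds.2 fun a => tendsto_pi_nhds.2 fun b => ?_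
  have hX : X ⊆ Finset.range (X.sup id + 1) := fun x hx =>
    Finset.mem_range.2 (Nat.lt_succ_of_le (Finset.le_sup (f := id) hx))
  have hlim := h.tendsto_reducedState hgap hX a b
  rw [prod_ofFn_mulVec _ (fun j => if h : (j : ℕ) ∈ X then
    φ (a ⟨j, h⟩) * star (φ (b ⟨j, h⟩)) else 1)] at hlim
  · rw [dotProduct_smul, h.covec_dotProduct, smul_eq_mul, mul_one,
      prod_fin_dite hX fun x => φ (a x) * star (φ (b x))] at hlim
    exact hlim
  · intro j
    by_cases hj : (j : ℕ) ∈ X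
    · simp only [hj, dite_true]
      exact siteOp_mulVec_of_amplitudes h.isHermitian hA _ _
    · simp only [hj, dite_false, one_smul]
      exact h.transferOp_mulVec

theorem sum_norm_sq_prod_eq_one {ι : Type*} [Fintype ι] [DecidableEq ι] {φ : Fin d → ℂ}
    (hφ : ∑ i, ‖φ i‖ ^ 2 = 1) : ∑ s : ι → Fin d, ‖∏ j, φ (s j)‖ ^ 2 = 1 := by
  have h := Finset.prod_univ_sum (fun _ : ι => (Finset.univ : Finset (Fin d)))
    fun _ i => ‖φ i‖ ^ 2
  simp only [hφ, Finset.prod_const_one, Fintype.piFinset_univ] at h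
  rw [h]
  exact Finset.sum_congr rfl fun s _ => by rw [norm_prod, Finset.prod_pow]

theorem prod_ofFn_mul_of_amplitudes {A : Fin d → Matrix (Fin D) (Fin D) ℂ}
    {P : Matrix (Fin D) (Fin D) ℂ} {φ : Fin d → ℂ} (hA : ∀ i, A i * P = φ i • P) {n : ℕ}
    (s : Fin n → Fin d) : (List.ofFn fun j => A (s j)).prod * P = (∏ j, φ (s j)) • P := by
  induction n with
  | zero => simp
  | succ n ih =>
    rw [List.ofFn_succ, List.prod_cons, mul_assoc, ih fun j => s j.succ, mul_smul_comm, hA,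
      smul_smul, Fin.prod_univ_succ, mul_comm]

/-- With a one-dimensional leading block, the distance of the state vector from a product
vector tends to zero as the chain grows: the difference is the contribution of the other blocks,
`s ↦ tr ((1 - P) A^{s₁} ⋯ A^{sₙ})`. -/
theorem IsLeadingBlock.tendsto_sum_norm_sq_sub {A : Fin d → Matrix (Fin D) (Fin D) ℂ}
    {P Λ : Matrix (Fin D) (Fin D) ℂ} (h : IsLeadingBlock A P Λ)
    (hgap : IsGapped (transferOp A) 1) {φ : Fin d → ℂ} (hA : ∀ i, A i * P = φ i • P)
    (htr : P.trace = 1) :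
    Tendsto (fun n : ℕ => ∑ s : Fin n → Fin d, ‖stateVector A n s - ∏ j, φ (s j)‖ ^ 2) atTop
      (𝓝 0) := by
  set Q : Matrix (Fin D) (Fin D) ℂ := 1 - P with hQ
  have h1 : ∀ n : ℕ, ((Q ⊗ₖ Q.map star) * transferOp A ^ n).trace =
      ((∑ s : Fin n → Fin d, ‖stateVector A n s - ∏ j, φ (s j)‖ ^ 2 : ℝ) : ℂ) := fun n => by
    rw [transferOp_pow, Finset.mul_sum, trace_sum]
    push_cast
    refine Finset.sum_congr rfl fun s _ => ?_
    set W := (List.ofFn fun j => A (s j)).prod with hW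
    have hs : (Q * W).trace = stateVector A n s - ∏ j, φ (s j) := by
      rw [trace_mul_comm, hQ, mul_sub, mul_one, trace_sub, hW, prod_ofFn_mul_of_amplitudes hA,
        trace_smul, htr, smul_eq_mul, mul_one]
      rfl
    have hmap : Q.map star * W.map star = (Q * W).map star :=
      (Matrix.map_mul (f := starRingEnd ℂ)).symm
    rw [← mul_kronecker_mul, hmap, trace_kronecker, trace_map_star, ← hs]
    exact Complex.mul_conj' _
  have h2 : Tendsto (fun n : ℕ => ((Q ⊗ₖ Q.map star) * transferOp A ^ n).trace) atTop (𝓝 0) := by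
    have hc : Continuous fun M : Matrix (Fin D × Fin D) (Fin D × Fin D) ℂ =>
        ((Q ⊗ₖ Q.map star) * M).trace := by fun_prop
    have h3 := (hc.tendsto _).comp (h.tendsto_pow hgap)
    have h4 : Q * P = 0 := by rw [hQ, sub_mul, one_mul, h.mul_self, sub_self]
    rw [trace_mul_vecMulVec, kronecker_mulVec_vecB, h4, zero_mul] at h3
    have h5 : vecB (0 : Matrix (Fin D) (Fin D) ℂ) = 0 := rfl
    rw [h5, dotProduct_zero] at h3
    exact h3
  have h3 := h2.norm
  rw [norm_zero] at h3
  refine h3.congr fun n => ?_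
  rw [h1, Complex.norm_real, Real.norm_of_nonneg (by positivity)]

theorem norm_star_dotProduct_sub_one_sq_le {m : Type*} [Fintype m] {w : m → ℂ}
    (hw : ∑ s, ‖w s‖ ^ 2 = 1) (ψ : m → ℂ) :
    ‖star w ⬝ᵥ ψ - 1‖ ^ 2 ≤ ∑ s, ‖ψ s - w s‖ ^ 2 := by
  have h1 : star w ⬝ᵥ w = 1 := by
    have : star w ⬝ᵥ w = ((∑ s, ‖w s‖ ^ 2 : ℝ) : ℂ) := by
      push_cast
      refine Finset.sum_congr rfl fun s _ => ?_
      exact Complex.conj_mul' _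
    rw [this, hw, Complex.ofReal_one]
  have h2 : star w ⬝ᵥ ψ - 1 = ∑ s, star (w s) * (ψ s - w s) := by
    rw [← h1, ← dotProduct_sub]
    rfl
  have h3 := norm_sum_mul_sq_le Finset.univ (fun s => star (w s)) fun s => ψ s - w s
  simp only [norm_star, hw, one_mul] at h3
  rwa [h2]

/-- Reducing to a subsystem does not decrease the fidelity with a product vector, so that the
fidelity of the whole chain bounds the purity of every reduced state. -/
theorem sq_fidelity_le_purity (A : Fin d → Matrix (Fin D) (Fin D) ℂ) {n : ℕ} {X : Finset ℕ}
    (hX : X ⊆ Finset.range n) {φ : Fin d → ℂ} (hφ : ∑ i, ‖φ i‖ ^ 2 = 1) :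
    (‖(transferOp A ^ n).trace‖⁻¹ *
      ‖star (fun s : Fin n → Fin d => ∏ j, φ (s j)) ⬝ᵥ stateVector A n‖ ^ 2) ^ 2 ≤
      purity (reducedState A n X) := by
  let v : (X → Fin d) → ℂ := fun a => ∏ x, φ (a x)
  let u : ({j : Fin n // (j : ℕ) ∉ X} → Fin d) → ℂ := fun c => ∏ j, φ (c j)
  let g : ({j : Fin n // (j : ℕ) ∉ X} → Fin d) → ℂ := fun c =>
    ∑ a, star (v a) * stateVector A n (glue a c)
  have hv : ∑ a, ‖v a‖ ^ 2 = 1 := sum_norm_sq_prod_eq_one hφ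
  have hu : ∑ c, ‖u c‖ ^ 2 = 1 := sum_norm_sq_prod_eq_one hφ
  have hw : ∀ a c, ∏ j, φ (glue a c j) = v a * u c := fun a c => by
    rw [← Fintype.prod_subtype_mul_prod_subtype (fun j : Fin n => (j : ℕ) ∈ X)]
    congr 1
    · let e : {j : Fin n // (j : ℕ) ∈ X} ≃ X :=
        { toFun := fun j => ⟨j, j.2⟩
          invFun := fun x => ⟨⟨x, Finset.mem_range.1 (hX x.2)⟩, x.2⟩
          left_inv := fun _ => rfl
          right_inv := fun _ => rfl }
      refine Fintype.prod_equiv e _ _ fun j => ?_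
      simp [glue, e, j.2]
    · refine Finset.prod_congr rfl fun j _ => ?_
      simp [glue, j.2]
  have h1 : star (fun s : Fin n → Fin d => ∏ j, φ (s j)) ⬝ᵥ stateVector A n =
      ∑ c, star (u c) * g c := by
    rw [dotProduct, sum_eq_sum_glue hX, Finset.sum_comm]
    refine Finset.sum_congr rfl fun c _ => ?_
    rw [Finset.mul_sum]
    refine Finset.sum_congr rfl fun a _ => ?_
    rw [Pi.star_apply, hw, star_mul']
    ring
  have h2 : star v ⬝ᵥ (reducedState A n X *ᵥ v) =
      (transferOp A ^ n).trace⁻¹ * ((∑ c, ‖g c‖ ^ 2 : ℝ) : ℂ) := by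
    have hg : ((∑ c, ‖g c‖ ^ 2 : ℝ) : ℂ) = ∑ c, ∑ a, ∑ b,
        star (v a) * stateVector A n (glue a c) * (star (stateVector A n (glue b c)) * v b) := by
      push_cast
      refine Finset.sum_congr rfl fun c _ => ?_
      rw [← Complex.mul_conj', ← Finset.sum_mul_sum]
      congr 1
      rw [map_sum]
      refine Finset.sum_congr rfl fun b _ => ?_
      simp [mul_comm]
    rw [hg, Finset.sum_comm, Finset.mul_sum, dotProduct]
    refine Finset.sum_congr rfl fun a _ => ?_
    rw [Finset.sum_comm, Finset.mul_sum, mulVec, dotProduct, Finset.mul_sum]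
    refine Finset.sum_congr rfl fun b _ => ?_
    simp only [reducedState, of_apply, densityMatrix_apply, Finset.mul_sum, Finset.sum_mul,
      Pi.star_apply]
    exact Finset.sum_congr rfl fun c _ => by ring
  have h3 := sq_norm_expectation_le_purity (reducedState A n X) hv
  rw [h2, norm_mul, norm_inv, Complex.norm_real, Real.norm_of_nonneg (by positivity)] at h3
  refine le_trans ?_ h3
  have h4 := norm_sum_mul_sq_le Finset.univ (fun c => star (u c)) g
  simp only [norm_star, hu, one_mul] at h4
  rw [h1]
  gcongr

theorem IsLeadingBlock.tendsto_entropyEveryKth {A : Fin d → Matrix (Fin D) (Fin D) ℂ}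
    {P Λ : Matrix (Fin D) (Fin D) ℂ} (h : IsLeadingBlock A P Λ)
    (hgap : IsGapped (transferOp A) 1) (hr : P.rank = 1) {α : ℝ≥0∞} (hα : 1 < α) {k : ℕ}
    (hk : 1 ≤ k) :
    Tendsto (fun p : ℕ => entropyEveryKth A α k (k * p)) atTop (𝓝 0) := by
  obtain ⟨φ, hφ, hA, htr⟩ := h.exists_amplitudes hr
  let b : ℕ → ℝ := fun n => (‖(transferOp A ^ n).trace‖⁻¹ *
      ‖star (fun s : Fin n → Fin d => ∏ j, φ (s j)) ⬝ᵥ stateVector A n‖ ^ 2) ^ 2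
  have hov : Tendsto (fun n : ℕ => star (fun s : Fin n → Fin d => ∏ j, φ (s j)) ⬝ᵥ
      stateVector A n) atTop (𝓝 1) := by
    rw [tendsto_iff_norm_sub_tendsto_zero]
    have h1 : Tendsto (fun n : ℕ => ‖star (fun s : Fin n → Fin d => ∏ j, φ (s j)) ⬝ᵥ
        stateVector A n - 1‖ ^ 2) atTop (𝓝 0) :=
      squeeze_zero (fun n => by positivity)
        (fun n => norm_star_dotProduct_sub_one_sq_le (sum_norm_sq_prod_eq_one hφ) _)
        (h.tendsto_sum_norm_sq_sub hgap hA htr)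
    have h2 := h1.sqrt
    simpa using h2
  have hb : Tendsto b atTop (𝓝 1) := by
    have h1 := hgap.tendsto_trace_pow.norm.inv₀ (by simp)
    simpa [b] using (h1.mul (hov.norm.pow 2)).pow 2
  have hkp := tendsto_mul_const_atTop hk
  set C : ℝ := if α = ⊤ then 1 else α.toReal / (α.toReal - 1) with hC
  have hC0 : 0 ≤ C := by
    rw [hC]
    split_ifs with htop
    · exact zero_le_one
    · have : 1 < α.toReal := by
        rw [← ENNReal.toReal_one]
        exact (ENNReal.toReal_lt_toReal ENNReal.one_ne_top htop).2 hα
      exact div_nonneg (by linarith) (by linarith)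
  have hup : Tendsto (fun p : ℕ => C * -Real.log (b (k * p))) atTop (𝓝 0) := by
    have := (((hb.comp hkp).log one_ne_zero).neg).const_mul C
    simpa using this
  have hev : ∀ᶠ p : ℕ in atTop, 0 ≤ entropyEveryKth A α k (k * p) ∧
      entropyEveryKth A α k (k * p) ≤ C * -Real.log (b (k * p)) := by
    filter_upwards [hkp.eventually hgap.eventually_trace_ne_zero,
      (hb.comp hkp).eventually (lt_mem_nhds zero_lt_one)] with p hp hbp
    have h1 := renyiEntropy_mem_Icc (reducedState_posSemidef A (k * p) (everyKth k (k * p)))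
      (trace_reducedState A (everyKth_subset k _) hp) hα
    refine ⟨h1.1, h1.2.trans (mul_le_mul_of_nonneg_left (neg_le_neg ?_) hC0)⟩
    exact Real.log_le_log hbp (sq_fidelity_le_purity A (everyKth_subset k _) hφ)
  exact tendsto_of_tendsto_of_tendsto_of_le_of_le' tendsto_const_nhds hup
    (hev.mono fun _ h => h.1) (hev.mono fun _ h => h.2)

theorem entropyDensity_eq_zero_of_tendsto (A : Fin d → Matrix (Fin D) (Fin D) ℂ) {k : ℕ}
    (hk : 1 ≤ k) (h : Tendsto (fun p : ℕ => entropyEveryKth A 2 k (k * p)) atTop (𝓝 0)) :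
    entropyDensity A k = 0 := by
  have h1 : Tendsto (fun p : ℕ => (k : ℝ) / ((k * p : ℕ) : ℝ)) atTop (𝓝 0) :=
    (tendsto_const_div_atTop_nhds_zero_nat (k : ℝ)).comp (tendsto_mul_const_atTop hk)
  have h2 := h1.mul h
  rw [mul_zero] at h2
  exact (EReal.tendsto_coe.2 h2).liminf_eq

/-! ### The limiting one-site state -/

/-- The limit of the reduced state of a single site, for the leading block `(P, Λ)`:
its matrix elements are `tr (Λ Aⁱ P (Aʲ)†)`. -/
noncomputable def siteState (A : Fin d → Matrix (Fin D) (Fin D) ℂ)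
    (P Λ : Matrix (Fin D) (Fin D) ℂ) : Matrix (Fin d) (Fin d) ℂ :=
  of fun i j => covec Λ ⬝ᵥ (siteOp A i j *ᵥ vecB P)

theorem siteState_apply (A : Fin d → Matrix (Fin D) (Fin D) ℂ)
    (P Λ : Matrix (Fin D) (Fin D) ℂ) (i j : Fin d) :
    siteState A P Λ i j = (Λ * (A i * P * (A j)ᴴ)).trace := by
  rw [siteState, of_apply, siteOp_mulVec_vecB, covec_dotProduct_vecB]

/-- `Λ` is injective on the range of `P`, because its kernel contains that of `P` and the ranks
agree. -/
theorem IsLeadingBlock.mulVec_eq_zero {A : Fin d → Matrix (Fin D) (Fin D) ℂ}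
    {P Λ : Matrix (Fin D) (Fin D) ℂ} (h : IsLeadingBlock A P Λ) {x : Fin D → ℂ}
    (hx : Λ *ᵥ x = 0) : P *ᵥ x = 0 := by
  have hle : LinearMap.ker P.mulVecLin ≤ LinearMap.ker Λ.mulVecLin := fun y hy => by
    rw [LinearMap.mem_ker, mulVecLin_apply] at hy ⊢
    rw [← h.mul_projector, ← mulVec_mulVec, hy, mulVec_zero]
  have h1 := P.mulVecLin.finrank_range_add_finrank_ker
  have h2 := Λ.mulVecLin.finrank_range_add_finrank_ker
  have h3 : Module.finrank ℂ Λ.mulVecLin.range = Module.finrank ℂ P.mulVecLin.range := h.rank_eq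
  have heq := Submodule.eq_of_le_of_finrank_eq hle (by omega)
  have : x ∈ LinearMap.ker P.mulVecLin := by
    rw [heq]; exact hx
  exact this

/-- A positive semidefinite matrix is a square `S† S`. -/
theorem exists_conjTranspose_mul_self {m : Type} [Fintype m] [DecidableEq m] {Λ : Matrix m m ℂ}
    (h : Λ.PosSemidef) : ∃ S : Matrix m m ℂ, Λ = Sᴴ * S := by
  open scoped MatrixOrder in
  exact CStarAlgebra.nonneg_iff_eq_star_mul_self.mp h.nonneg

/-- Equality in the Cauchy-Schwarz inequality, for a family of vectors whose Gram matrix has trace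
one and purity at least one: all of them are multiples of one vector. -/
theorem exists_smul_of_one_le_sum_norm_inner {ι E : Type*} [Fintype ι] [NormedAddCommGroup E]
    [InnerProductSpace ℂ E] (v : ι → E) (h1 : ∑ i, ‖v i‖ ^ 2 = 1)
    (h2 : 1 ≤ ∑ i, ∑ j, ‖inner ℂ (v j) (v i)‖ ^ 2) :
    ∃ i₀, v i₀ ≠ 0 ∧ ∀ i, ∃ c : ℂ, v i = c • v i₀ := by
  have hle : ∀ i j, ‖inner ℂ (v j) (v i)‖ ^ 2 ≤ ‖v i‖ ^ 2 * ‖v j‖ ^ 2 := fun i j => by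
    rw [← mul_pow, mul_comm]
    exact pow_le_pow_left₀ (norm_nonneg _) (norm_inner_le_norm _ _) 2
  have hsum : ∑ i, ∑ j, ‖v i‖ ^ 2 * ‖v j‖ ^ 2 = 1 := by
    rw [← Finset.sum_mul_sum, h1, one_mul]
  have heq : ∀ i j, ‖inner ℂ (v j) (v i)‖ ^ 2 = ‖v i‖ ^ 2 * ‖v j‖ ^ 2 := by
    have h3 : ∑ i, ∑ j, ‖inner ℂ (v j) (v i)‖ ^ 2 = ∑ i, ∑ j, ‖v i‖ ^ 2 * ‖v j‖ ^ 2 :=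
      le_antisymm (Finset.sum_le_sum fun i _ => Finset.sum_le_sum fun j _ => hle i j)
        (hsum.le.trans h2)
    have h4 := (Finset.sum_eq_sum_iff_of_le
      fun i _ => Finset.sum_le_sum fun j (_ : j ∈ Finset.univ) => hle i j).1 h3
    intro i j
    exact (Finset.sum_eq_sum_iff_of_le fun j _ => hle i j).1 (h4 i (Finset.mem_univ i)) j
      (Finset.mem_univ j)
  obtain ⟨i₀, hi₀⟩ : ∃ i, v i ≠ 0 := by
    by_contra! hn
    simp [hn] at h1
  refine ⟨i₀, hi₀, fun i => ?_⟩
  by_cases hi : v i = 0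
  · exact ⟨0, by rw [hi, zero_smul]⟩
  have h5 : ‖inner ℂ (v i₀) (v i)‖ = ‖v i₀‖ * ‖v i‖ := by
    have := heq i i₀
    rw [← mul_pow, mul_comm ‖v i‖] at this
    exact (pow_left_inj₀ (norm_nonneg _) (by positivity) two_ne_zero).1 this
  obtain ⟨r, -, hr⟩ := (norm_inner_eq_norm_iff hi₀ hi).1 h5
  exact ⟨r, hr⟩

/-- If the limiting one-site state is pure, then the tensor acts on the leading block as
`Aⁱ P = cᵢ M` with one matrix `M`. The map `X ↦ Σ |cᵢ|² M X M†` fixes `P` and therefore `M`; since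
the fixed point is unique, `M` is a multiple of `P`, so that every operator on the block is a fixed
point, and the block has dimension one. -/
theorem IsLeadingBlock.rank_eq_one_of_one_le_purity {A : Fin d → Matrix (Fin D) (Fin D) ℂ}
    {P Λ : Matrix (Fin D) (Fin D) ℂ} (h : IsLeadingBlock A P Λ)
    (hgap : IsGapped (transferOp A) 1) (hq : 1 ≤ purity (siteState A P Λ)) : P.rank = 1 := by
  obtain ⟨S, hS⟩ := exists_conjTranspose_mul_self h.posSemidef
  let v : Fin d → EuclideanSpace ℂ (Fin D × Fin D) := fun i => WithLp.toLp 2 (vecB (S * A i * P))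
  have hinner : ∀ i j, inner ℂ (v j) (v i) = siteState A P Λ i j := fun i j => by
    have e1 : A i * P * (A j)ᴴ = A i * P * (A j * P)ᴴ := by
      rw [conjTranspose_mul, h.isHermitian.eq, ← mul_assoc, mul_assoc (A i) P P, h.mul_self]
    have e2 : (Λ * (A i * P * (A j)ᴴ)).trace = ((S * A i * P) * (S * A j * P)ᴴ).trace := by
      rw [e1, hS, mul_assoc Sᴴ, trace_mul_comm Sᴴ, mul_assoc S (A j) P, conjTranspose_mul S]
      simp only [mul_assoc]
    rw [siteState_apply, e2, EuclideanSpace.inner_eq_star_dotProduct, Matrix.trace]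
    simp only [v, dotProduct, Fintype.sum_prod_type, diag_apply,
      Matrix.mul_apply (M := S * A i * P), conjTranspose_apply, Pi.star_apply, vecB]
  have hn : ∑ i, ‖v i‖ ^ 2 = 1 := by
    have e : ((∑ i, ‖v i‖ ^ 2 : ℝ) : ℂ) = (Λ * cpMap A P).trace := by
      rw [cpMap, Finset.mul_sum, trace_sum]
      push_cast
      refine Finset.sum_congr rfl fun i _ => ?_
      rw [← siteState_apply, ← hinner, inner_self_eq_norm_sq_to_K]
      rfl
    rw [h.cpMap_eq, h.mul_projector, h.trace_eq] at e
    exact_mod_cast e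
  have hq' : 1 ≤ ∑ i, ∑ j, ‖inner ℂ (v j) (v i)‖ ^ 2 := by
    simpa only [hinner, purity] using hq
  obtain ⟨i₀, hi₀, hc⟩ := exists_smul_of_one_le_sum_norm_inner v hn hq'
  choose c hc using hc
  set M := A i₀ * P with hM
  -- `S` is injective on the range of `P`
  have hAc : ∀ i, A i * P = c i • M := fun i => by
    have e1 : S * A i * P = c i • (S * A i₀ * P) := by
      apply vecB_injective
      exact congrArg WithLp.ofLp (hc i)
    have e2 : Λ * (A i * P - c i • M) = 0 := by
      rw [hS, mul_assoc, mul_sub, mul_smul_comm, hM, ← mul_assoc S, ← mul_assoc S, e1, sub_self,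
        mul_zero]
    have e3 : P * (A i * P - c i • M) = A i * P - c i • M := by
      rw [mul_sub, mul_smul_comm, hM, ← mul_assoc P, ← mul_assoc P, h.comm, h.comm,
        mul_assoc _ P P, mul_assoc _ P P, h.mul_self]
    have e4 : P * (A i * P - c i • M) = 0 := by
      refine Matrix.ext_of_mulVec_single fun j => ?_
      rw [← mulVec_mulVec, zero_mulVec]
      apply h.mulVec_eq_zero
      rw [mulVec_mulVec, e2, zero_mulVec]
    rw [e3] at e4
    exact sub_eq_zero.1 e4
  set s : ℂ := ∑ i, c i * star (c i) with hs
  have hcp : ∀ X, P * X * P = X → cpMap A X = s • (M * X * Mᴴ) := fun X hX => by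
    rw [cpMap, hs, Finset.sum_smul]
    refine Finset.sum_congr rfl fun i _ => ?_
    have e1 : A i * X * (A i)ᴴ = (A i * P) * X * (A i * P)ᴴ := by
      rw [conjTranspose_mul, h.isHermitian.eq]
      conv_lhs => rw [← hX]
      simp only [mul_assoc]
    rw [e1, hAc, conjTranspose_smul, smul_mul_assoc, smul_mul_assoc, mul_smul_comm, smul_smul]
  have hPM : P * M = M := by rw [hM, ← mul_assoc, h.comm, mul_assoc, h.mul_self]
  have hMP : M * P = M := by rw [hM, mul_assoc, h.mul_self]
  have hMM : s • (M * Mᴴ) = P := by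
    have := hcp P (by rw [h.mul_self, h.mul_self])
    rw [h.cpMap_eq, hMP] at this
    exact this.symm
  have hMfix : cpMap A M = M := by
    rw [hcp M (by rw [hPM, hMP]), mul_assoc, ← mul_smul_comm, hMM, hMP]
  have huniq : ∀ X, cpMap A X = X → ∃ z : ℂ, X = z • P := fun X hX => by
    obtain ⟨z, hz⟩ := hgap.eigenvector_unique (vecB_ne_zero h.ne_zero) h.transferOp_mulVec
      (v := vecB X) (by rw [transferOp_mulVec_vecB, hX])
    exact ⟨z, vecB_injective hz⟩
  obtain ⟨z, hz⟩ := huniq M hMfix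
  have hsz : s * (z * star z) = 1 := by
    have e : (s * (z * star z)) • P = (1 : ℂ) • P := by
      rw [one_smul]
      conv_rhs => rw [← hMM, hz]
      rw [conjTranspose_smul, h.isHermitian.eq, smul_mul_smul_comm, h.mul_self, smul_smul]
    exact smul_left_injective ℂ h.ne_zero e
  have hall : ∀ X, P * X * P = X → ∃ y : ℂ, X = y • P := fun X hX => huniq X (by
    rw [hcp X hX, hz, conjTranspose_smul, h.isHermitian.eq, smul_mul_assoc, smul_mul_assoc,
      mul_smul_comm, hX, smul_smul, smul_smul, mul_assoc, hsz, one_smul])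
  -- a nonzero vector in the range of `P`
  obtain ⟨x, hx⟩ : ∃ x, P *ᵥ x ≠ 0 := by
    by_contra! hn
    exact h.ne_zero (Matrix.ext_of_mulVec_single fun j => by rw [hn, zero_mulVec])
  set p := P *ᵥ x with hp
  have hPp : P *ᵥ p = p := by rw [hp, mulVec_mulVec, h.mul_self]
  have hpP : star p ᵥ* P = star p := by
    conv_rhs => rw [← hPp, star_mulVec, h.isHermitian.eq]
  obtain ⟨y, hy⟩ := hall (vecMulVec p (star p)) (by rw [mul_vecMulVec, vecMulVec_mul, hPp, hpP])
  have hne : vecMulVec p (star p) ≠ 0 := by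
    rw [Ne, vecMulVec_eq_zero, not_or]
    exact ⟨hx, by simpa using hx⟩
  have hy0 : y ≠ 0 := by
    rintro rfl
    rw [zero_smul] at hy
    exact hne hy
  rw [← rank_smul_of_mem_nonZeroDivisors P (mem_nonZeroDivisors_of_ne_zero hy0), ← hy]
  exact (rank_eq_one_iff_exists_vecMulVec _).2 ⟨hne, p, star p, rfl⟩

/-! ### Vanishing entropy density forces purity -/

theorem isClosed_setOf_unimodular_eigenvalue (m : Type) [Fintype m] [DecidableEq m] :
    IsClosed {M : Matrix m m ℂ | ∃ z : Circle, (scalar m (z : ℂ) - M).det = 0} := by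
  have hc : IsClosed {x : Circle × Matrix m m ℂ | (scalar m (x.1 : ℂ) - x.2).det = 0} := by
    refine isClosed_eq ?_ continuous_const
    have : Continuous fun x : Circle × Matrix m m ℂ => scalar m (x.1 : ℂ) - x.2 := by
      simp only [scalar_apply]
      fun_prop
    exact this.matrix_det
  have := isClosedMap_snd_of_compactSpace _ hc
  convert this using 1
  ext M
  simp

theorem det_scalar_sub_eq_zero_iff {m : Type} [Fintype m] [DecidableEq m] (M : Matrix m m ℂ)
    (z : ℂ) : (scalar m z - M).det = 0 ↔ ∃ v : m → ℂ, v ≠ 0 ∧ M *ᵥ v = z • v := by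
  rw [← exists_mulVec_eq_zero_iff]
  refine exists_congr fun v => and_congr_right fun _ => ?_
  rw [sub_mulVec, sub_eq_zero, eq_comm, scalar_apply, ← smul_one_eq_diagonal, smul_mulVec,
    one_mulVec]

/-- As `k → ∞`, the twisted transfer operator tends to a matrix of rank one, whose nonzero
eigenvalue is the purity of the limiting one-site state. -/
theorem IsLeadingBlock.one_le_purity_of_entropyDensity {A : Fin d → Matrix (Fin D) (Fin D) ℂ}
    {P Λ : Matrix (Fin D) (Fin D) ℂ} (h : IsLeadingBlock A P Λ)
    (hgap : IsGapped (transferOp A) 1)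
    (hk : ∀ k₀ : ℕ, ∃ k : ℕ, k₀ ≤ k ∧ 2 ≤ k ∧ entropyDensity A k = 0) :
    1 ≤ purity (siteState A P Λ) := by
  have : Nonempty (Fin D × Fin D) := hgap.nonempty
  set W := partialSwap D * (transferOp A ⊗ₖ transferOp A) * partialSwap D with hW
  set r := vecB P with hr
  set l := covec Λ with hl
  set K := vecMulVec r l ⊗ₖ vecMulVec r l with hK
  have hfreq : ∃ᶠ k in atTop, twistedTransferOp A k ∈
      {M : Matrix ((Fin D × Fin D) × (Fin D × Fin D)) ((Fin D × Fin D) × (Fin D × Fin D)) ℂ |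
        ∃ z : Circle, (scalar _ (z : ℂ) - M).det = 0} := by
    refine frequently_atTop.2 fun k₀ => ?_
    obtain ⟨k, hk0, hk2, hk⟩ := hk k₀
    refine ⟨k, hk0, ?_⟩
    obtain ⟨t, ht⟩ := exists_isTopEigenvalue (twistedTransferOp A k)
    obtain ⟨ht0, hent⟩ := entropyDensity_eq hgap (by omega) ht
    rw [hk] at hent
    have hlog : Real.log ‖t‖ = 0 := by
      have : (0 : ℝ) = -Real.log ‖t‖ := by exact_mod_cast hent
      linarith
    have htn : ‖t‖ = 1 :=
      Real.eq_one_of_pos_of_log_eq_zero (norm_pos_iff.2 ht0) hlog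
    refine ⟨⟨t, by simpa [Submonoid.unitSphere] using htn⟩, ?_⟩
    rw [det_scalar_sub_eq_zero_iff]
    obtain ⟨v, hv⟩ := ht.1.exists_hasEigenvector
    exact ⟨v, hv.2, by simpa using hv.apply_eq_smul⟩
  have hlim : Tendsto (fun k => twistedTransferOp A k) atTop (𝓝 (K * W)) := by
    have h1 : Tendsto (fun k : ℕ => (transferOp A ^ (k - 1)) ⊗ₖ (transferOp A ^ (k - 1))) atTop
        (𝓝 K) := by
      have hc : Continuous fun M : Matrix (Fin D × Fin D) (Fin D × Fin D) ℂ => M ⊗ₖ M := by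
        refine continuous_matrix fun i j => ?_
        simp only [kroneckerMap_apply]
        fun_prop
      exact (hc.tendsto _).comp ((h.tendsto_pow hgap).comp (tendsto_sub_atTop_nat 1))
    have hc : Continuous fun M : Matrix ((Fin D × Fin D) × (Fin D × Fin D))
        ((Fin D × Fin D) × (Fin D × Fin D)) ℂ => M * W := by fun_prop
    refine ((hc.tendsto _).comp h1).congr fun k => ?_
    simp only [Function.comp_apply, twistedTransferOp, kronecker_pow', hW, mul_assoc]
  obtain ⟨z, hz⟩ := (isClosed_setOf_unimodular_eigenvalue _).mem_of_frequently_of_tendsto hfreq hlim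
  obtain ⟨v, hv0, hv⟩ := (det_scalar_sub_eq_zero_iff _ _).1 hz
  let x : (Fin D × Fin D) × (Fin D × Fin D) → ℂ := fun q => r q.1 * r q.2
  let y : (Fin D × Fin D) × (Fin D × Fin D) → ℂ := fun q => l q.1 * l q.2
  have hKxy : K = vecMulVec x y := by
    ext p q
    simp only [hK, x, y, kroneckerMap_apply, vecMulVec_apply]
    ring
  rw [hKxy, vecMulVec_mul, vecMulVec_mulVec] at hv
  have hz0 : (z : ℂ) ≠ 0 := Circle.coe_ne_zero z
  have hyv : (y ᵥ* W) ⬝ᵥ v ≠ 0 := fun h0 => by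
    rw [h0] at hv
    have : (z : ℂ) • v = 0 := by rw [← hv]; simp
    exact hv0 ((smul_eq_zero.1 this).resolve_left hz0)
  have hzval : (y ᵥ* W) ⬝ᵥ x = z := by
    have h1 := congrArg (fun u => (y ᵥ* W) ⬝ᵥ u) hv
    simp only [dotProduct_smul, smul_eq_mul, MulOpposite.smul_eq_mul_unop,
      MulOpposite.unop_op] at h1
    exact mul_right_cancel₀ hyv h1
  -- the eigenvalue is the purity, since the swap turns the site operator into
  -- `∑ i j, siteOp A i j ⊗ siteOp A j i`
  have hkr : ∀ M N : Matrix (Fin D × Fin D) (Fin D × Fin D) ℂ,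
      y ⬝ᵥ ((M ⊗ₖ N) *ᵥ x) = (l ⬝ᵥ (M *ᵥ r)) * (l ⬝ᵥ (N *ᵥ r)) := fun M N => by
    have : (M ⊗ₖ N) *ᵥ x = fun q => (M *ᵥ r) q.1 * (N *ᵥ r) q.2 := by
      funext q
      simp only [x, mulVec, dotProduct, kroneckerMap_apply, Finset.sum_mul_sum]
      rw [Fintype.sum_prod_type]
      exact Finset.sum_congr rfl fun a _ => Finset.sum_congr rfl fun b _ => by ring
    rw [this]
    simp only [y, dotProduct, Finset.sum_mul_sum]
    rw [Fintype.sum_prod_type]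
    exact Finset.sum_congr rfl fun a _ => Finset.sum_congr rfl fun b _ => by ring
  have hsum : ∑ i, ∑ j, siteState A P Λ i j * siteState A P Λ j i = z := by
    rw [← hzval, ← dotProduct_mulVec, hW, partialSwap_conj]
    simp only [sum_mulVec, dotProduct_sum, hkr]
    rfl
  have hcs := norm_sum_mul_sq_le Finset.univ
    (fun p : Fin d × Fin d => siteState A P Λ p.1 p.2) fun p => siteState A P Λ p.2 p.1
  rw [Fintype.sum_prod_type, Fintype.sum_prod_type, Fintype.sum_prod_type, hsum, Circle.norm_coe,
    Finset.sum_comm (f := fun i j => ‖siteState A P Λ j i‖ ^ 2)] at hcs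
  change 1 ^ 2 ≤ purity _ * purity _ at hcs
  nlinarith [purity_nonneg (siteState A P Λ)]

/-! ### Product limits force purity -/

theorem norm_trace_sq_le {m : Type} [Fintype m] (M : Matrix m m ℂ) :
    ‖M.trace‖ ^ 2 ≤ Fintype.card m * purity M := by
  have h := norm_sum_mul_sq_le Finset.univ (fun _ : m => (1 : ℂ)) fun a => M a a
  simp only [one_mul, norm_one, one_pow, Finset.sum_const, Finset.card_univ, nsmul_eq_mul,
    mul_one] at h
  refine h.trans (mul_le_mul_of_nonneg_left ?_ (Nat.cast_nonneg _))
  exact Finset.sum_le_sum fun a _ => Finset.single_le_sum (f := fun b => ‖M a b‖ ^ 2)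
    (fun b _ => by positivity) (Finset.mem_univ a)

/-- A positive matrix of small rank cannot have small purity. -/
theorem norm_trace_mul_conjTranspose_sq_le {α β : Type} [Fintype α] [DecidableEq α] [Fintype β]
    [DecidableEq β] (V : Matrix α β ℂ) :
    ‖(V * Vᴴ).trace‖ ^ 2 ≤ Fintype.card β * purity (V * Vᴴ) := by
  have h1 : purity (V * Vᴴ) = purity (Vᴴ * V) := by
    have e : (purity (V * Vᴴ) : ℂ) = purity (Vᴴ * V) := by
      rw [ofReal_purity (isHermitian_mul_conjTranspose_self V),
        ofReal_purity (isHermitian_conjTranspose_mul_self V)]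
      change ((V * Vᴴ) * (V * Vᴴ)).trace = ((Vᴴ * V) * (Vᴴ * V)).trace
      rw [Matrix.mul_assoc V, trace_mul_comm V]
      simp only [Matrix.mul_assoc]
    exact_mod_cast e
  rw [h1, trace_mul_comm]
  exact norm_trace_sq_le _

theorem purity_piProd {ι : Type} [Fintype ι] [DecidableEq ι] (σ : ι → Matrix (Fin d) (Fin d) ℂ) :
    purity (of fun a b : ι → Fin d => ∏ x, σ x (a x) (b x)) = ∏ x, purity (σ x) := by
  have h1 : ∀ x, purity (σ x) = ∑ p : Fin d × Fin d, ‖σ x p.1 p.2‖ ^ 2 := fun x => by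
    rw [Fintype.sum_prod_type]; rfl
  rw [Finset.prod_congr rfl fun x _ => h1 x, Finset.prod_univ_sum, Fintype.piFinset_univ, purity,
    ← Fintype.sum_prod_type']
  refine Fintype.sum_equiv (Equiv.arrowProdEquivProdArrow ι (fun _ => Fin d) fun _ => Fin d).symm
    _ _ fun q => ?_
  rw [of_apply, norm_prod, Finset.prod_pow]
  rfl

theorem trace_piProd {ι : Type} [Fintype ι] [DecidableEq ι] (σ : ι → Matrix (Fin d) (Fin d) ℂ) :
    (of fun a b : ι → Fin d => ∏ x, σ x (a x) (b x)).trace = ∏ x, (σ x).trace := by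
  simp only [Matrix.trace, diag_apply, of_apply]
  rw [Finset.prod_univ_sum, Fintype.piFinset_univ]

theorem dotProduct_prod_ofFn_single {m : Type} [Fintype m] [DecidableEq m] {T : Matrix m m ℂ}
    {r l : m → ℂ} (hr : T *ᵥ r = r) (hl : l ᵥ* T = l) (B : Matrix m m ℂ) {N : ℕ} (x : Fin N) :
    l ⬝ᵥ ((List.ofFn fun y => if y = x then B else T).prod *ᵥ r) = l ⬝ᵥ (B *ᵥ r) := by
  induction N with
  | zero => exact x.elim0
  | succ N ih =>
    rw [List.ofFn_succ, List.prod_cons, ← mulVec_mulVec]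
    induction x using Fin.cases with
    | zero =>
      rw [if_pos rfl, prod_ofFn_mulVec _ (fun _ => 1) r, Finset.prod_const_one, one_smul]
      intro j
      rw [if_neg (Fin.succ_ne_zero j), hr, one_smul]
    | succ x =>
      rw [if_neg (Fin.succ_ne_zero x).symm, dotProduct_mulVec, hl, ← ih x]
      simp only [Fin.succ_inj]

/-- If the limiting state of an interval is a product, then its factors are the one-site state:
both sides agree after taking the partial trace over all other sites. -/
theorem eq_siteState_of_product {A : Fin d → Matrix (Fin D) (Fin D) ℂ}
    {P Λ : Matrix (Fin D) (Fin D) ℂ} (h : IsLeadingBlock A P Λ) {N : ℕ}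
    {σ : Fin N → Matrix (Fin d) (Fin d) ℂ} (htr : ∀ x, (σ x).trace = 1)
    (hprod : ∀ s s' : Fin N → Fin d,
      covec Λ ⬝ᵥ ((List.ofFn fun j => siteOp A (s j) (s' j)).prod *ᵥ vecB P) =
        ∏ j, σ j (s j) (s' j)) (x : Fin N) : σ x = siteState A P Λ := by
  ext i i'
  let t : Fin N → Finset (Fin d) := fun y => if y = x then {i} else Finset.univ
  let M : Fin N → Fin d → Matrix (Fin D × Fin D) (Fin D × Fin D) ℂ := fun y u =>
    siteOp A u (if y = x then i' else u)
  have h1 : ∑ s ∈ Fintype.piFinset t, ∏ y, σ y (s y) (if y = x then i' else s y) = σ x i i' := by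
    rw [← Finset.prod_univ_sum t fun y u => σ y u (if y = x then i' else u),
      Finset.prod_eq_single x]
    · simp [t]
    · intro y _ hy
      simp only [t, hy, if_false]
      exact htr y
    · simp
  have h2 : ∑ s ∈ Fintype.piFinset t, covec Λ ⬝ᵥ
      ((List.ofFn fun j => M j (s j)).prod *ᵥ vecB P) = siteState A P Λ i i' := by
    rw [← dotProduct_sum, ← sum_mulVec, sum_piFinset_prod_ofFn]
    have : (fun j => ∑ u ∈ t j, M j u) =
        fun j => if j = x then siteOp A i i' else transferOp A := by
      funext j
      by_cases hj : j = x
      · simp [t, M, hj]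
      · simp [t, M, hj, transferOp, siteOp]
    rw [this, dotProduct_prod_ofFn_single h.transferOp_mulVec h.vecMul_transferOp]
    rfl
  rw [← h1, ← h2]
  exact Finset.sum_congr rfl fun s _ => (hprod s _).symm

/-- If all reduced states tend to product states, then the one-site state is pure: the purity of a
product over `N` sites is a power of the one-site purity, but it is bounded below in `N` because
the reduced state of an interval has rank at most `D ^ 2`. -/
theorem IsLeadingBlock.one_le_purity_of_tendsto_productState
    {A : Fin d → Matrix (Fin D) (Fin D) ℂ} {P Λ : Matrix (Fin D) (Fin D) ℂ}
    (h : IsLeadingBlock A P Λ) (hgap : IsGapped (transferOp A) 1)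
    (hX : ∀ X : Finset ℕ, ∃ σ : ℕ → Matrix (Fin d) (Fin d) ℂ,
      (∀ x, (σ x).PosSemidef ∧ (σ x).trace = 1) ∧
      Tendsto (fun n : ℕ => reducedState A n X) atTop (𝓝 (productState X σ))) :
    1 ≤ purity (siteState A P Λ) := by
  obtain ⟨S, hS⟩ := exists_conjTranspose_mul_self h.posSemidef
  have hlb : ∀ N : ℕ, 1 ≤ (D * D : ℝ) * purity (siteState A P Λ) ^ N := by
    intro N
    obtain ⟨σ, hσ, hlim⟩ := hX (Finset.range N)
    have hprod : ∀ s s' : Fin N → Fin d,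
        covec Λ ⬝ᵥ ((List.ofFn fun j => siteOp A (s j) (s' j)).prod *ᵥ vecB P) =
          ∏ j : Fin N, σ j (s j) (s' j) := fun s s' => by
      let e : (Fin N → Fin d) → (Finset.range N → Fin d) := fun s x =>
        s ⟨x, Finset.mem_range.1 x.2⟩
      have h1 := h.tendsto_reducedState hgap (Finset.Subset.refl (Finset.range N)) (e s) (e s')
      have h2 := tendsto_pi_nhds.1 (tendsto_pi_nhds.1 hlim (e s)) (e s')
      have h3 := tendsto_nhds_unique h1 h2
      have h4 : (List.ofFn fun j : Fin N => if hj : (j : ℕ) ∈ Finset.range N then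
          siteOp A (e s ⟨j, hj⟩) (e s' ⟨j, hj⟩) else transferOp A) =
          List.ofFn fun j => siteOp A (s j) (s' j) := by
        congr 1
        funext j
        simp [e]
      rw [h4] at h3
      rw [h3, productState, of_apply, ← prod_fin_dite (Finset.Subset.refl (Finset.range N))]
      refine Finset.prod_congr rfl fun j _ => ?_
      simp [e]
    have hsite := eq_siteState_of_product h (σ := fun j : Fin N => σ j) (fun x => (hσ x).2) hprod
    -- the limiting state of the interval factorizes through the `D * D` dimensional bond space
    let V : Matrix (Fin N → Fin d) (Fin D × Fin D) ℂ := of fun s =>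
      vecB (S * (List.ofFn fun j => A (s j)).prod * P)
    have hV : V * Vᴴ = of fun s s' : Fin N → Fin d => ∏ j : Fin N, σ j (s j) (s' j) := by
      ext s s'
      set w := (List.ofFn fun j => A (s j)).prod with hw
      set w' := (List.ofFn fun j => A (s' j)).prod with hw'
      have e0 : (List.ofFn fun j => siteOp A (s j) (s' j)).prod = w ⊗ₖ w'.map star := by
        rw [hw, hw', prod_ofFn_map_star, prod_ofFn_kronecker]
        rfl
      have e1 : w * P * w'ᴴ = w * P * (w' * P)ᴴ := by
        rw [conjTranspose_mul, h.isHermitian.eq, ← mul_assoc, mul_assoc w P P, h.mul_self]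
      have e2 : (Λ * (w * P * w'ᴴ)).trace = ((S * w * P) * (S * w' * P)ᴴ).trace := by
        rw [e1, hS, mul_assoc Sᴴ, trace_mul_comm Sᴴ, mul_assoc S w' P, conjTranspose_mul S]
        simp only [mul_assoc]
      rw [of_apply, ← hprod, e0, kronecker_mulVec_vecB, covec_dotProduct_vecB, e2, Matrix.trace]
      simp only [Matrix.mul_apply (M := V), V, Fintype.sum_prod_type, diag_apply,
        Matrix.mul_apply (M := S * w * P), conjTranspose_apply, of_apply, vecB]
      rfl
    have hmain := norm_trace_mul_conjTranspose_sq_le V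
    rw [hV, trace_piProd fun j : Fin N => σ j, purity_piProd fun j : Fin N => σ j,
      Finset.prod_eq_one fun (j : Fin N) _ => (hσ j).2] at hmain
    simpa [hsite] using hmain
  by_contra! hlt
  have hlim := (tendsto_pow_atTop_nhds_zero_of_lt_one (purity_nonneg _) hlt).const_mul (D * D : ℝ)
  rw [mul_zero] at hlim
  obtain ⟨N, hN⟩ := (hlim.eventually (gt_mem_nhds zero_lt_one)).exists
  exact (hlb N).not_gt hN

/-! ### Gauge transformations -/

/-- The gauge transform `Aⁱ ↦ G Aⁱ G⁻¹` of a tensor. -/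
noncomputable def gauge (G : GL (Fin D) ℂ) (A : Fin d → Matrix (Fin D) (Fin D) ℂ) :
    Fin d → Matrix (Fin D) (Fin D) ℂ :=
  fun i => (G : Matrix (Fin D) (Fin D) ℂ) * A i * ((G⁻¹ : GL (Fin D) ℂ) : Matrix (Fin D) (Fin D) ℂ)

theorem stateVector_gauge (G : GL (Fin D) ℂ) (A : Fin d → Matrix (Fin D) (Fin D) ℂ) (n : ℕ) :
    stateVector (gauge G A) n = stateVector A n := by
  funext s
  have h : ∀ (n : ℕ) (s : Fin n → Fin d), (List.ofFn fun j => gauge G A (s j)).prod =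
      (G : Matrix (Fin D) (Fin D) ℂ) * (List.ofFn fun j => A (s j)).prod *
        ((G⁻¹ : GL (Fin D) ℂ) : Matrix (Fin D) (Fin D) ℂ) := by
    intro n
    induction n with
    | zero => intro s; simp
    | succ n ih =>
      intro s
      rw [List.ofFn_succ, List.ofFn_succ, List.prod_cons, List.prod_cons, ih fun j => s j.succ,
        gauge]
      simp only [mul_assoc]
      rw [Units.inv_mul_cancel_left]
  rw [stateVector, h, trace_mul_comm, ← mul_assoc, Units.inv_mul, one_mul]
  rfl

theorem reducedState_gauge (G : GL (Fin D) ℂ) (A : Fin d → Matrix (Fin D) (Fin D) ℂ) (n : ℕ)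
    (X : Finset ℕ) : reducedState (gauge G A) n X = reducedState A n X := by
  simp only [reducedState, densityMatrix, stateVector_gauge]

theorem entropyEveryKth_gauge (G : GL (Fin D) ℂ) (A : Fin d → Matrix (Fin D) (Fin D) ℂ)
    (α : ℝ≥0∞) (k n : ℕ) : entropyEveryKth (gauge G A) α k n = entropyEveryKth A α k n := by
  have h : ∀ {m : Type} [Fintype m] [DecidableEq m] {ρ σ : Matrix m m ℂ} (hρ : ρ.IsHermitian)
      (hσ : σ.IsHermitian), ρ = σ → renyiEntropy hρ α = renyiEntropy hσ α := by
    intro m _ _ ρ σ hρ hσ e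
    subst e
    rfl
  exact h _ _ (reducedState_gauge G A n _)

theorem entropyDensity_gauge (G : GL (Fin D) ℂ) (A : Fin d → Matrix (Fin D) (Fin D) ℂ) (k : ℕ) :
    entropyDensity (gauge G A) k = entropyDensity A k := by
  simp only [entropyDensity, entropyEveryKth_gauge]

theorem IsGapped.gauge {A : Fin d → Matrix (Fin D) (Fin D) ℂ} (hA : IsGapped (transferOp A) 1)
    (G : GL (Fin D) ℂ) : IsGapped (transferOp (gauge G A)) 1 := by
  let Gi : Matrix (Fin D) (Fin D) ℂ := ((G⁻¹ : GL (Fin D) ℂ) : Matrix (Fin D) (Fin D) ℂ)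
  let Gm : Matrix (Fin D) (Fin D) ℂ := G
  have hmap : ∀ M N : Matrix (Fin D) (Fin D) ℂ, (M * N).map star = M.map star * N.map star :=
    fun M N => Matrix.map_mul (f := starRingEnd ℂ)
  have hmap1 : (1 : Matrix (Fin D) (Fin D) ℂ).map star = 1 :=
    Matrix.map_one _ (star_zero ℂ) (star_one ℂ)
  have hinv : (Gi ⊗ₖ Gi.map star) * (Gm ⊗ₖ Gm.map star) = 1 := by
    rw [← mul_kronecker_mul, ← hmap, Units.inv_mul, hmap1, one_kronecker_one]
  have h : transferOp (MPS.gauge G A) =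
      (Gm ⊗ₖ Gm.map star) * transferOp A * (Gi ⊗ₖ Gi.map star) := by
    rw [transferOp, transferOp, Finset.mul_sum, Finset.sum_mul]
    refine Finset.sum_congr rfl fun i _ => ?_
    rw [← mul_kronecker_mul, ← mul_kronecker_mul, ← hmap, ← hmap]
    rfl
  rw [IsGapped, h, charpoly_mul_comm, ← mul_assoc, hinv, one_mul]
  exact hA

theorem exists_rank_one_fixedPoint_gauge (G : GL (Fin D) ℂ)
    {A : Fin d → Matrix (Fin D) (Fin D) ℂ}
    (h : ∃ X : Matrix (Fin D) (Fin D) ℂ, cpMap A X = X ∧ X.rank = 1) :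
    ∃ X : Matrix (Fin D) (Fin D) ℂ, cpMap (gauge G A) X = X ∧ X.rank = 1 := by
  obtain ⟨X, hX, hr⟩ := h
  let Gi : Matrix (Fin D) (Fin D) ℂ := ((G⁻¹ : GL (Fin D) ℂ) : Matrix (Fin D) (Fin D) ℂ)
  let Gm : Matrix (Fin D) (Fin D) ℂ := G
  have hinv : Gi * Gm = 1 := Units.inv_mul G
  have hinv' : Gmᴴ * Giᴴ = 1 := by rw [← conjTranspose_mul, hinv, conjTranspose_one]
  have hdet : IsUnit Gm.det := (isUnit_iff_isUnit_det Gm).1 G.isUnit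
  refine ⟨Gm * X * Gmᴴ, ?_, ?_⟩
  · have h1 : ∀ i, gauge G A i * (Gm * X * Gmᴴ) * (gauge G A i)ᴴ =
        Gm * (A i * X * (A i)ᴴ) * Gmᴴ := fun i => by
      change (Gm * A i * Gi) * (Gm * X * Gmᴴ) * (Gm * A i * Gi)ᴴ = _
      calc (Gm * A i * Gi) * (Gm * X * Gmᴴ) * (Gm * A i * Gi)ᴴ
          = Gm * A i * (Gi * Gm) * X * (Gmᴴ * Giᴴ) * (A i)ᴴ * Gmᴴ := by
            simp only [conjTranspose_mul, mul_assoc]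
        _ = _ := by rw [hinv, hinv', mul_one, mul_one]; simp only [mul_assoc]
    rw [cpMap, Finset.sum_congr rfl fun i _ => h1 i, ← Finset.sum_mul, ← Finset.mul_sum]
    change Gm * cpMap A X * Gmᴴ = _
    rw [hX]
  · rw [rank_mul_eq_left_of_isUnit_det _ _ (by rw [det_conjTranspose]; exact hdet.star),
      rank_mul_eq_right_of_isUnit_det _ _ hdet, hr]

theorem gauge_inv_gauge (G : GL (Fin D) ℂ) (A : Fin d → Matrix (Fin D) (Fin D) ℂ) :
    gauge G⁻¹ (gauge G A) = A := by
  funext i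
  simp only [gauge, inv_inv, mul_assoc, Units.inv_mul_cancel_left, Units.inv_mul, mul_one]

theorem IsLeadingBlock.exists_rank_one_iff {A : Fin d → Matrix (Fin D) (Fin D) ℂ}
    {P Λ : Matrix (Fin D) (Fin D) ℂ} (h : IsLeadingBlock A P Λ)
    (hgap : IsGapped (transferOp A) 1) :
    (∃ X : Matrix (Fin D) (Fin D) ℂ, cpMap A X = X ∧ X.rank = 1) ↔ P.rank = 1 := by
  constructor
  · rintro ⟨X, hX, hr⟩
    obtain ⟨c, hc⟩ := hgap.eigenvector_unique (vecB_ne_zero h.ne_zero) h.transferOp_mulVec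
      (v := vecB X) (by rw [transferOp_mulVec_vecB, hX])
    have hXP : X = c • P := vecB_injective hc
    have hc0 : c ≠ 0 := by
      rintro rfl
      rw [hXP, zero_smul, rank_zero] at hr
      exact zero_ne_one hr
    rwa [hXP, rank_smul_of_mem_nonZeroDivisors P (mem_nonZeroDivisors_of_ne_zero hc0)] at hr
  · exact fun hr => ⟨P, h.cpMap_eq, hr⟩

end MPS

theorem mainTheorem1 {d D : ℕ} (A : Fin d → Matrix (Fin D) (Fin D) ℂ)
    (hgap : MPS.IsGapped (MPS.transferOp A) 1) :
    -- the entropy density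
    (∀ k : ℕ, 2 ≤ k → ∃ t : ℂ, MPS.IsTopEigenvalue (MPS.twistedTransferOp A k) t ∧ t ≠ 0 ∧
      MPS.entropyDensity A k = ((-Real.log ‖t‖ : ℝ) : EReal)) ∧
    -- the equivalences, for a tensor that is canonical up to a gauge transformation
    ((∃ G : GL (Fin D) ℂ, MPS.IsCanonicalForm fun i =>
        (G : Matrix (Fin D) (Fin D) ℂ) * A i * ((G⁻¹ : GL (Fin D) ℂ) : Matrix (Fin D) (Fin D) ℂ)) →
      List.TFAE [
        -- (i) the highest eigenvector of the transfer operator is a product vector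
        ∃ v : Fin D × Fin D → ℂ, v ≠ 0 ∧ (MPS.transferOp A).mulVec v = v ∧ MPS.IsProductVector v,
        -- (i') the highest eigenoperator of the completely positive map has rank one
        ∃ X : Matrix (Fin D) (Fin D) ℂ, MPS.cpMap A X = X ∧ X.rank = 1,
        -- (ii) the entropy density vanishes for arbitrarily large `k`
        ∀ k₀ : ℕ, ∃ k : ℕ, k₀ ≤ k ∧ 2 ≤ k ∧ MPS.entropyDensity A k = 0,
        -- (iii) all Rényi entropies with `1 < α ≤ ∞` tend to zero, for every `k ≥ 2`
        ∀ α : ℝ≥0∞, 1 < α → ∀ k : ℕ, 2 ≤ k →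
          Filter.Tendsto (fun p : ℕ => MPS.entropyEveryKth A α k (k * p)) Filter.atTop (𝓝 0),
        -- (iv) every finite subsystem tends to a site-wise product of density matrices
        ∀ X : Finset ℕ, ∃ σ : ℕ → Matrix (Fin d) (Fin d) ℂ,
          (∀ x, (σ x).PosSemidef ∧ (σ x).trace = 1) ∧
          Filter.Tendsto (fun n : ℕ => MPS.reducedState A n X) Filter.atTop
            (𝓝 (MPS.productState X σ)),
        -- (iv') every finite subsystem tends to a product of copies of one pure state
        ∃ φ : Fin d → ℂ, ∑ i, ‖φ i‖ ^ 2 = 1 ∧ ∀ X : Finset ℕ,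
          Filter.Tendsto (fun n : ℕ => MPS.reducedState A n X) Filter.atTop
            (𝓝 (MPS.productState X fun _ => Matrix.vecMulVec φ (star φ)))]) := by
  refine ⟨fun k hk => ?_, ?_⟩
  · have : Nonempty (Fin D × Fin D) := hgap.nonempty
    obtain ⟨t, ht⟩ := MPS.exists_isTopEigenvalue (MPS.twistedTransferOp A k)
    exact ⟨t, ht, MPS.entropyDensity_eq hgap (by omega) ht⟩
  rintro ⟨G, hG⟩
  change MPS.IsCanonicalForm (MPS.gauge G A) at hG
  have hgapG := hgap.gauge G
  obtain ⟨P, Λ, hblock⟩ := hG.exists_isLeadingBlock hgapG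
  have hrank : (∃ X : Matrix (Fin D) (Fin D) ℂ, MPS.cpMap A X = X ∧ X.rank = 1) ↔ P.rank = 1 := by
    rw [← hblock.exists_rank_one_iff hgapG]
    refine ⟨MPS.exists_rank_one_fixedPoint_gauge G, fun h => ?_⟩
    have := MPS.exists_rank_one_fixedPoint_gauge G⁻¹ h
    rwa [MPS.gauge_inv_gauge] at this
  tfae_have 1 ↔ 2 := MPS.exists_productVector_iff A
  tfae_have 2 → 4 := fun h α hα k hk => by
    simpa only [MPS.entropyEveryKth_gauge] using
      hblock.tendsto_entropyEveryKth hgapG (hrank.1 h) hα (k := k) (by omega)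
  tfae_have 4 → 3 := fun h k₀ => ⟨max k₀ 2, le_max_left _ _, le_max_right _ _,
    MPS.entropyDensity_eq_zero_of_tendsto A (le_trans (by norm_num) (le_max_right k₀ 2))
      (h 2 (by norm_num) _ (le_max_right _ _))⟩
  tfae_have 3 → 2 := fun h => hrank.2 <| hblock.rank_eq_one_of_one_le_purity hgapG <|
    hblock.one_le_purity_of_entropyDensity hgapG <| by
      simpa only [MPS.entropyDensity_gauge] using h
  tfae_have 2 → 6 := fun h => by
    obtain ⟨φ, hφ, hA, -⟩ := hblock.exists_amplitudes (hrank.1 h)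
    refine ⟨φ, hφ, fun X => ?_⟩
    simpa only [MPS.reducedState_gauge] using hblock.tendsto_productState hgapG hA X
  tfae_have 6 → 5 := fun ⟨φ, hφ, h⟩ X => by
    refine ⟨fun _ => Matrix.vecMulVec φ (star φ), fun _ =>
      ⟨Matrix.posSemidef_vecMulVec_self_star φ, ?_⟩, h X⟩
    have h1 : (Matrix.vecMulVec φ (star φ)).trace = ((∑ i, ‖φ i‖ ^ 2 : ℝ) : ℂ) := by
      push_cast
      exact Finset.sum_congr rfl fun i _ => Complex.mul_conj' _
    rw [h1, hφ, Complex.ofReal_one]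
  tfae_have 5 → 2 := fun h => hrank.2 <| hblock.rank_eq_one_of_one_le_purity hgapG <|
    hblock.one_le_purity_of_tendsto_productState hgapG <| by
      simpa only [MPS.reducedState_gauge] using h
  tfae_finish
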